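/- A developable ruled surface of class $C^{m}$ ($m\ge 2$, $m=\infty$ allowed) is a surface $S:\ x(u,v)=b(u)+v\,r(u)$, $u$ in an open interval, $v\in\mathbb R$, $r(u)\ne0$, in $\mathbb R^3$ whose tangent plane is constant along each ruling, where $b,r$ are of class $C^{m-1}$ and, near each ruling which contains a regular point ($x_u,x_v$ linearly independent), there is a unit normal field $n(u)$ of class $C^{m-1}$. (This covers planes, cylinders, cones and tangent surfaces of space curves.) A ruling is an inflection ruling if $n'=0$ there. Two surfaces have second order contact at a common regular point $q$ if the distance of points $x$ of the first from the second (near $q$) is $o(\|x-q\|^2)$ as $x\to q$. **Theorem 1.** Let $p$ be a regular point of a developable ruled surface $S$ of class $C^m$, and let $r_p$ be the ruling through $p$. There is a developable ruled surface $\Gamma$ of class $C^m$ such that: 1. $\Gamma$ has a planar Gauss image, that is, its unit normals lie in a plane $\langle d,n\rangle=c$ with $d\neq0$; 2. $\Gamma$ has $r_p$ as a ruling and has second order contact with $S$ at all regular points of $S$ on $r_p$ (these are regular points of $\Gamma$, too); 3. $\Gamma$ contains a curve $a\subset S$ through $p$ which is transversal to the rulings of $S$ and of $\Gamma$. If $r_p$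 is not an inflection ruling, $\Gamma$ can be chosen as follows. There are Cartesian coordinates $(x,y,z)$ with origin $p$, a real number $k$, and functions $h,f$ of class $C^m$ near $0$ with $h(0)=\dot h(0)=0$, $\rho_0:=\ddot h(0)\neq0$, $f(0)=\dot f(0)=\ddot f(0)=0$, such that: * the curve $a$ is the section of $S$ with the plane $z=0$ near $p$; it is the envelope of the lines $x\cos u+y\sin u+h(u)=0$, parametrized as $\mathbf a(u)=(-h\cos u+\dot h\sin u,\,-h\sin u-\dot h\cos u,\,0)$; * $\Gamma$ is the envelope of the planes $x\cos u+y\sin u-kz+h(u)=0$, which pass through the tangents of $a$ and have constant inclination to the $z$-axis; it is parametrized as $\mathbf g(u,v)=\mathbf a(u)+v\,(k\cos u,k\sin u,1)$; * near $r_p$, the tangent planes of $S$ are $x\cos u+y\sin u+(f(u)-k)z+h(u)=0$, and $S$ is reparametrized as $\mathbf s(u,v)=\mathbf a(u)+v\,((k-f)\cos u+\dot f\sin u,\,(k-f)\sin u-\dot f\cos u,\,1)$; * the rotational cone (cylinder, if $k=0$) $\Gamma_p:\ \mathbf g_p(u,v)=(\rho_0-\rho_0\cos u,\,-\rho_0\sin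 u,\,0)+v\,(k\cos u,k\sin u,1)$, whose axis is parallel to the $z$-axis, has second order contact with $S$ at all regular points of $S$ on $r_p$ (osculating cone). If, moreover, $m\ge3$, then, with $f(u)=a_3u^3+o(u^3)$, $\rho=h+\ddot h$ and $\dot\rho_0=\dot\rho(0)$, one has for every fixed $v$, as $u\to0$, $$\|\mathbf s-\mathbf g\|=|3a_3v|\,u^2+o(u^2),\qquad \|\mathbf s-\mathbf g_p\|=\left|\tfrac{\dot\rho_0}{2}+3a_3v\right|u^2+o(u^2),$$ and the distances $\bar\delta,\bar\delta_p$ between the parallel tangents, in the plane $z=v$, at these points of $S$ and $\Gamma$, respectively of $S$ and $\Gamma_p$ (the components of $\mathbf s-\mathbf g$ and $\mathbf s-\mathbf g_p$ along $(\cos u,\sin u,0)$), satisfy $$\bar\delta=|a_3v|\,|u|^3+o(|u|^3),\qquad \bar\delta_p=\left|\tfrac{\dot\rho_0}{6}+a_3v\right||u|^3+o(|u|^3).$$ -/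

import Mathlib

open Filter Topology Asymptotics

/-- Euclidean three-space. -/
abbrev E3 : Type := EuclideanSpace ℝ (Fin 3)

/-- A parametrized ruled surface `(u, v) ↦ base u + v • dir u` with `u ∈ dom`, `v ∈ ℝ`;
the rulings are the lines `u = const`. -/
structure RuledSurface where
  dom : Set ℝ
  base : ℝ → E3
  dir : ℝ → E3

namespace RuledSurface

/-- The point with parameters `q = (u, v)`. -/
noncomputable def pt (S : RuledSurface) (q : ℝ × ℝ) : E3 := S.base q.1 + q.2 • S.dir q.1

/-- The partial derivative with respect to `u`; the one with respect to `v` is `dir u`. -/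
noncomputable def du (S : RuledSurface) (u v : ℝ) : E3 := deriv S.base u + v • deriv S.dir u

/-- `(u, v)` is a regular point: the two partial derivatives are linearly independent. -/
def IsRegular (S : RuledSurface) (u v : ℝ) : Prop :=
  LinearIndependent ℝ ![S.du u v, S.dir u]

/-- `n` is orthogonal to the surface at all points of the ruling with parameter `u`. -/
def IsNormalAt (S : RuledSurface) (u : ℝ) (n : E3) : Prop :=
  inner ℝ n (S.dir u) = 0 ∧ ∀ v : ℝ, inner ℝ n (S.du u v) = 0

/-- `n` is a unit normal field along the rulings with parameters in `J`. -/
def IsUnitNormalOn (S : RuledSurface) (n : ℝ → E3) (J : Set ℝ) : Prop :=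
  ∀ u ∈ J, ‖n u‖ = 1 ∧ S.IsNormalAt u (n u)

/-- A developable ruled surface of class `C^(k+1)` (`k ≥ 1`): the tangent plane is constant along
each ruling. The surface is of class `C^(k+1)` at its regular points since the parametrization and
the unit normal are of class `C^k`. -/
structure IsDevelopable (S : RuledSurface) (k : ℕ∞) : Prop where
  isOpen_dom : IsOpen S.dom
  ordConnected_dom : S.dom.OrdConnected
  contDiffOn_base : ContDiffOn ℝ k S.base S.dom
  contDiffOn_dir : ContDiffOn ℝ k S.dir S.dom
  dir_ne_zero : ∀ u ∈ S.dom, S.dir u ≠ 0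
  exists_normal : ∀ u ∈ S.dom, ∀ v : ℝ, S.IsRegular u v →
    ∃ n : ℝ → E3, ∃ J ∈ 𝓝 u, J ⊆ S.dom ∧ ContDiffOn ℝ k n J ∧ S.IsUnitNormalOn n J

/-- The Gauss image (traced by a continuous unit normal) lies in a plane
`{x | ⟪d, x⟫ = c}` of the space of normals. -/
def HasPlanarGaussImage (S : RuledSurface) : Prop :=
  ∃ n : ℝ → E3, ContinuousOn n S.dom ∧ S.IsUnitNormalOn n S.dom ∧
    ∃ d : E3, d ≠ 0 ∧ ∃ c : ℝ, ∀ u ∈ S.dom, inner ℝ d (n u) = c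

/-- The ruling with parameter `u` is an inflection ruling: the Gauss map is stationary there. -/
def IsInflection (S : RuledSurface) (u : ℝ) : Prop :=
  ∃ n : ℝ → E3, ∃ J ∈ 𝓝 u, S.IsUnitNormalOn n J ∧ HasDerivAt n 0 u

end RuledSurface

/-- Second order contact of the surface `X` at the parameter `s` with the surface `Y` at the
parameter `t`: the point is common, and the distance of a point `x` of `X` from `Y` (from an
arbitrarily small piece of `Y` around the common point `q`) is `o(‖x - q‖²)` as `x → q`.
At regular points of surfaces of class `C²` this says that the two surfaces, as graphs over their
common tangent plane, have the same derivatives up to order two. -/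
def SecondOrderContact (X : ℝ × ℝ → E3) (s : ℝ × ℝ) (Y : ℝ × ℝ → E3) (t : ℝ × ℝ) : Prop :=
  X s = Y t ∧ ∀ V ∈ 𝓝 t,
    (fun s' => Metric.infDist (X s') (Y '' V)) =o[𝓝 s] (fun s' => ‖X s' - X s‖ ^ 2)

/-- The unit vector with angle `t` in the plane spanned by `e 0` and `e 1`. -/
noncomputable def radial (e : OrthonormalBasis (Fin 3) ℝ E3) (t : ℝ) : E3 :=
  Real.cos t • e 0 + Real.sin t • e 1

/-- The derivative of `radial`. -/
noncomputable def tangential (e : OrthonormalBasis (Fin 3) ℝ E3) (t : ℝ) : E3 :=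
  -(Real.sin t) • e 0 + Real.cos t • e 1

/-- The envelope of the planes `x cos t + y sin t + g(t) z + h(t) = 0`, in the Cartesian coordinates
with origin `o` and axes `e 0, e 1, e 2`. The base curve is the section with `z = 0`, which has the
support function `h`, and `v` is the coordinate `z`. -/
noncomputable def envelope (J : Set ℝ) (o : E3) (e : OrthonormalBasis (Fin 3) ℝ E3)
    (h g : ℝ → ℝ) : RuledSurface where
  dom := J
  base t := o - h t • radial e t - deriv h t • tangential e t
  dir t := -(g t) • radial e t - deriv g t • tangential e t + e 2

/-- The rotational cone (`κ ≠ 0`) or cylinder (`κ = 0`) with axis `m + ℝ e 2` which meets the plane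
through `m` orthogonal to the axis in the circle of radius `|ρ|` around `m`; `|κ|` is the tangent
of the angle between rulings and axis. -/
noncomputable def rotationalCone (e : OrthonormalBasis (Fin 3) ℝ E3) (m : E3) (ρ κ : ℝ) :
    RuledSurface where
  dom := Set.univ
  base t := m - ρ • radial e t
  dir t := κ • radial e t + e 2

/-! Away from inflections, cut `S` by a plane `z = 0` through `p` transversal to the ruling, and use
the angle `t` of the tangent of the section as parameter. The tangent planes become `x cos t + y sin
t + g(t) z + h(t) = 0`, and `S` is their envelope. Taking `e 1` along the derivative of the normal
gives `g'(0) = 0`; the remaining rotation about `e 1` is one parameter `κ`, and exactly one value of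
it makes `g''(0) = 0` (`exists_envelopeChart`). Then `g = f - κ`, where `f` has vanishing 2-jet, and
`Γ` arises by replacing `g` with the constant `-κ`. Constant inclination of the planes is a planar
Gauss image.

The contact rests on `envelope_infDist_isLittleO`: envelopes whose pairs `(h, g)` have equal 2-jets
have second order contact. At equal `t` and height, the points differ by `o(t)` tangentially and
`o(t²)` radially. Sliding along the horizontal section of the second surface removes the tangential
part (`exists_root_near`) and changes the radial part only quadratically
(`isBigO_sq_of_deriv_bound`), because the velocity of the section is tangential. The cone is the
same construction with `h` replaced by the support function of the osculating circle, so contact and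
error estimates apply to it verbatim. The errors are the third order Taylor terms of `h - h₂ + v f`.

At an inflection ruling the angle is not a parameter. With `n = n(0) + o(t)`, both the cross section
and the ruling directions leave the tangent plane only by `o(t²)`, so the cylinder over the section
orthogonal to the ruling has the required contact (`cylinder_infDist_isLittleO`). -/

/-! ### Taylor estimates and perturbation of roots. -/

section Asymptotics

/-- Integration of `F' = o(tⁿ)`. -/
theorem isLittleO_pow_succ_of_hasDerivAt {F F' : ℝ → ℝ} {n : ℕ} (h0 : F 0 = 0)
    (hd : ∀ᶠ t in 𝓝 0, HasDerivAt F (F' t) t) (ho : F' =o[𝓝 0] fun t : ℝ => t ^ n) :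
    F =o[𝓝 0] fun t : ℝ => t ^ (n + 1) := by
  rw [isLittleO_iff] at ho ⊢
  intro c hc
  obtain ⟨δ, hδ, H⟩ := Metric.eventually_nhds_iff.1 (hd.and (ho hc))
  refine Metric.eventually_nhds_iff.2 ⟨δ, hδ, fun t ht => ?_⟩
  have habs : ∀ y ∈ Set.Icc (-|t|) |t|, dist y 0 < δ := fun y hy => by
    rw [Real.dist_eq, sub_zero] at *
    exact (abs_le.2 hy).trans_lt ht
  have := (convex_Icc (-|t|) |t|).norm_image_sub_le_of_norm_hasDerivWithin_le (f := F) (f' := F')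
    (C := c * |t| ^ n) (x := 0) (y := t)
    (fun y hy => (H (habs y hy)).1.hasDerivWithinAt)
    (fun y hy => ((H (habs y hy)).2).trans (by
      rw [norm_pow, Real.norm_eq_abs]
      have : |y| ≤ |t| := abs_le.2 hy
      gcongr))
    (by simp) ⟨neg_abs_le t, le_abs_self t⟩
  rw [h0, sub_zero, sub_zero, Real.norm_eq_abs t] at this
  rw [norm_pow, Real.norm_eq_abs t, pow_succ, ← mul_assoc]
  exact this

theorem HasDerivAt.isLittleO_id {F : ℝ → ℝ} (h0 : F 0 = 0) (h : HasDerivAt F 0 0) :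
    F =o[𝓝 0] fun t : ℝ => t := by
  have := h.isLittleO
  simpa [h0] using this

theorem isLittleO_of_two_jet_eq_zero {D D₁ : ℝ → ℝ} (h0 : D 0 = 0) (h1 : D₁ 0 = 0)
    (hD : ∀ᶠ t in 𝓝 0, HasDerivAt D (D₁ t) t) (h2 : HasDerivAt D₁ 0 0) :
    D =o[𝓝 0] (fun t : ℝ => t ^ 2) ∧ D₁ =o[𝓝 0] (fun t : ℝ => t) := by
  have := HasDerivAt.isLittleO_id h1 h2
  exact ⟨isLittleO_pow_succ_of_hasDerivAt (n := 1) h0 hD (by simpa using this), this⟩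

/-- Integrating the first order expansion of `D₂` twice. Differentiability of `D₂` is needed at `0`
only, which is what class `C³` provides. Both expansions are used: `D` is the radial and `D₁` the
tangential error. -/
theorem taylor_three {D D₁ D₂ : ℝ → ℝ} {c : ℝ} (h0 : D 0 = 0) (h1 : D₁ 0 = 0) (h2 : D₂ 0 = 0)
    (hD : ∀ᶠ t in 𝓝 0, HasDerivAt D (D₁ t) t) (hD₁ : ∀ᶠ t in 𝓝 0, HasDerivAt D₁ (D₂ t) t)
    (hD₂ : HasDerivAt D₂ c 0) :
    (fun t => D t - c / 6 * t ^ 3) =o[𝓝 0] (fun t : ℝ => t ^ 3) ∧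
      (fun t => D₁ t - c / 2 * t ^ 2) =o[𝓝 0] (fun t : ℝ => t ^ 2) := by
  have e2 : (fun t => D₂ t - c * t) =o[𝓝 0] (fun t : ℝ => t) := by
    refine HasDerivAt.isLittleO_id (by simp [h2]) ?_
    exact (hD₂.sub ((hasDerivAt_id (0 : ℝ)).const_mul c)).congr_deriv (by simp)
  have e1 : (fun t => D₁ t - c / 2 * t ^ 2) =o[𝓝 0] (fun t : ℝ => t ^ 2) := by
    refine isLittleO_pow_succ_of_hasDerivAt (n := 1) (by simp [h1]) ?_ (by simpa using e2)
    filter_upwards [hD₁] with t ht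
    refine (ht.sub ((hasDerivAt_pow 2 t).const_mul (c / 2))).congr_deriv ?_
    simp; ring
  refine ⟨isLittleO_pow_succ_of_hasDerivAt (n := 2) (by simp [h0]) ?_ e1, e1⟩
  filter_upwards [hD] with t ht
  refine (ht.sub ((hasDerivAt_pow 3 t).const_mul (c / 6))).congr_deriv ?_
  simp; ring

theorem isLittleO_norm_sub_norm {α E : Type*} [NormedAddCommGroup E] {l : Filter α}
    {x y : α → E} {g : α → ℝ} (h : (fun t => x t - y t) =o[l] g) :
    (fun t => ‖x t‖ - ‖y t‖) =o[l] g :=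
  (IsBigO.of_bound 1 (Eventually.of_forall fun t => by
    simpa using abs_norm_sub_norm_le (x t) (y t))).trans_isLittleO h

/-- Perturbation of the root `t = s.1` of a function with derivative near `c ≠ 0`. -/
theorem exists_root_near {A A' : ℝ × ℝ → ℝ → ℝ} {w c : ℝ} (hc : c ≠ 0)
    (hA : ∀ᶠ q : (ℝ × ℝ) × ℝ in 𝓝 ((0, w), 0), HasDerivAt (A q.1) (A' q.1 q.2) q.2)
    (hA' : Tendsto (fun q : (ℝ × ℝ) × ℝ => A' q.1 q.2) (𝓝 ((0, w), 0)) (𝓝 c))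
    (h0 : Tendsto (fun s => A s s.1) (𝓝 (0, w)) (𝓝 0)) :
    ∃ θ : ℝ × ℝ → ℝ, Tendsto θ (𝓝 (0, w)) (𝓝 0) ∧ (∀ᶠ s in 𝓝 (0, w), A s (θ s) = 0) ∧
      (fun s => θ s - s.1) =O[𝓝 (0, w)] (fun s => A s s.1) := by
  have hcp : 0 < |c| := abs_pos.2 hc
  have hb : ∀ᶠ q : (ℝ × ℝ) × ℝ in 𝓝 ((0, w), 0), |A' q.1 q.2 - c| < |c| / 2 := by
    have := Metric.tendsto_nhds.1 hA' (|c| / 2) (by positivity)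
    simpa [Real.dist_eq] using this
  have hev := hA.and hb
  rw [nhds_prod_eq (X := ℝ × ℝ), Metric.eventually_prod_nhds_iff] at hev
  obtain ⟨pa, hpa, δ, hδ, H⟩ := hev
  have key : ∀ᶠ s in 𝓝 ((0 : ℝ), w), ∃ t', A s t' = 0 ∧ |t' - s.1| ≤ 2 / |c| * |A s s.1| := by
    have h1 : ∀ᶠ s in 𝓝 ((0 : ℝ), w), |s.1| < δ / 2 := by
      have : Tendsto (fun s : ℝ × ℝ => |s.1|) (𝓝 (0, w)) (𝓝 0) := by
        simpa using ((continuous_fst (X := ℝ) (Y := ℝ)).abs.tendsto ((0 : ℝ), w))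
      exact this.eventually (gt_mem_nhds (by positivity))
    have h2 : ∀ᶠ s in 𝓝 ((0 : ℝ), w), 2 / |c| * |A s s.1| < δ / 2 := by
      have : Tendsto (fun s => 2 / |c| * |A s s.1|) (𝓝 (0, w)) (𝓝 0) := by
        simpa using h0.abs.const_mul (2 / |c|)
      exact this.eventually (gt_mem_nhds (by positivity))
    filter_upwards [hpa, h1, h2] with s hs hs1 hs2
    -- With this `η` the linear growth `|c| η = 2 |A s s.1|` pays for both the initial value `|A s
    -- s.1|` and the mean value error `|c| / 2 * η`, so `A s` changes sign on the interval of radius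
    -- `η`.
    set η := 2 / |c| * |A s s.1| with hη
    have hη0 : 0 ≤ η := by positivity
    have hcη : |c| * η = 2 * |A s s.1| := by rw [hη]; field_simp
    have hmem : ∀ y ∈ Set.Icc (s.1 - η) (s.1 + η), dist y 0 < δ := fun y hy => by
      rw [Real.dist_eq, sub_zero, abs_lt]
      obtain ⟨h3, h4⟩ := abs_lt.1 hs1
      constructor <;> linarith [hy.1, hy.2]
    have hsm : s.1 ∈ Set.Icc (s.1 - η) (s.1 + η) := ⟨by linarith, by linarith⟩
    have mv : ∀ y ∈ Set.Icc (s.1 - η) (s.1 + η),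
        |(A s y - c * y) - (A s s.1 - c * s.1)| ≤ |c| / 2 * |y - s.1| := fun y hy =>
      (convex_Icc (s.1 - η) (s.1 + η)).norm_image_sub_le_of_norm_hasDerivWithin_le
        (f := fun t => A s t - c * t) (f' := fun t => A' s t - c)
        (fun z hz => (((H hs (hmem z hz)).1.sub
          ((hasDerivAt_id z).const_mul c)).congr_deriv (by simp)).hasDerivWithinAt)
        (fun z hz => (H hs (hmem z hz)).2.le) hsm hy
    -- Multiplication by `c` makes the function increase on balance whatever the sign of `c`, which
    -- avoids a case distinction.
    have hcont : ContinuousOn (fun t => c * A s t) (Set.Icc (s.1 - η) (s.1 + η)) := fun z hz =>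
      ((H hs (hmem z hz)).1.continuousAt.const_mul c).continuousWithinAt
    have hcc : c * c = |c| * |c| := (abs_mul_abs_self c).symm
    have hcA := abs_le.1 (abs_mul c (A s s.1)).le
    have hright := mv (s.1 + η) ⟨by linarith, le_rfl⟩
    have hleft := mv (s.1 - η) ⟨le_rfl, by linarith⟩
    rw [show s.1 + η - s.1 = η by ring, abs_of_nonneg hη0] at hright
    rw [show s.1 - η - s.1 = -η by ring, abs_neg, abs_of_nonneg hη0] at hleft
    have hr : 0 ≤ c * A s (s.1 + η) := by
      have h3 := mul_le_mul_of_nonneg_left hright hcp.le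
      rw [← abs_mul] at h3
      have h4 := (abs_le.1 h3).1
      have h5 : |c| * (|c| / 2 * η) = |c| * |A s s.1| := by linear_combination |c| / 2 * hcη
      have h6 : c * c * η = 2 * (|c| * |A s s.1|) := by rw [hcc]; linear_combination |c| * hcη
      nlinarith [hcA.1, hcA.2]
    have hl : c * A s (s.1 - η) ≤ 0 := by
      have h3 := mul_le_mul_of_nonneg_left hleft hcp.le
      rw [← abs_mul] at h3
      have h4 := (abs_le.1 h3).2
      have h5 : |c| * (|c| / 2 * η) = |c| * |A s s.1| := by linear_combination |c| / 2 * hcη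
      have h6 : c * c * η = 2 * (|c| * |A s s.1|) := by rw [hcc]; linear_combination |c| * hcη
      nlinarith [hcA.1, hcA.2]
    obtain ⟨t', ht', ht0⟩ := intermediate_value_Icc (by linarith) hcont ⟨hl, hr⟩
    refine ⟨t', (mul_eq_zero.1 ht0).resolve_left hc, abs_le.2 ⟨?_, ?_⟩⟩ <;> linarith [ht'.1, ht'.2]
  choose! θ hθ using fun s (hs : ∃ t', A s t' = 0 ∧ |t' - s.1| ≤ 2 / |c| * |A s s.1|) => hs
  have hθ' : ∀ᶠ s in 𝓝 ((0 : ℝ), w), A s (θ s) = 0 ∧ |θ s - s.1| ≤ 2 / |c| * |A s s.1| :=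
    key.mono fun s hs => hθ s hs
  have hO : (fun s => θ s - s.1) =O[𝓝 (0, w)] (fun s => A s s.1) :=
    IsBigO.of_bound (2 / |c|) (hθ'.mono fun s hs => hs.2)
  refine ⟨θ, ?_, hθ'.mono fun s hs => hs.1, hO⟩
  have h1 : Tendsto (fun s : ℝ × ℝ => s.1) (𝓝 (0, w)) (𝓝 0) := continuous_fst.tendsto ((0 : ℝ), w)
  simpa using (hO.trans_tendsto h0).add h1

/-- Between `s.1` and `θ s` the derivative is at most `|M| * |θ s - s.1|`, so the mean value
inequality yields the square. This is the gain that turns an `o(t)` tangential correction into an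
`o(t²)` radial one. -/
theorem isBigO_sq_of_deriv_bound {B B' : ℝ × ℝ → ℝ → ℝ} {w M : ℝ} {θ : ℝ × ℝ → ℝ}
    (hB : ∀ᶠ q : (ℝ × ℝ) × ℝ in 𝓝 ((0, w), 0),
      HasDerivAt (B q.1) (B' q.1 q.2) q.2 ∧ |B' q.1 q.2| ≤ M * |q.2 - q.1.1|)
    (hθ : Tendsto θ (𝓝 (0, w)) (𝓝 0)) :
    (fun s => B s (θ s) - B s s.1) =O[𝓝 (0, w)] (fun s => (θ s - s.1) ^ 2) := by
  rw [nhds_prod_eq (X := ℝ × ℝ), Metric.eventually_prod_nhds_iff] at hB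
  obtain ⟨pa, hpa, δ, hδ, H⟩ := hB
  have h1 : Tendsto (fun s : ℝ × ℝ => s.1) (𝓝 (0, w)) (𝓝 0) := continuous_fst.tendsto ((0 : ℝ), w)
  refine IsBigO.of_bound |M| ?_
  filter_upwards [hpa, Metric.tendsto_nhds.1 hθ δ hδ, Metric.tendsto_nhds.1 h1 δ hδ] with s hs h2 h3
  have hmem : ∀ y ∈ Set.uIcc s.1 (θ s), dist y 0 < δ := fun y hy =>
    (convex_ball (0 : ℝ) δ).ordConnected.uIcc_subset h3 h2 hy
  have := (convex_uIcc s.1 (θ s)).norm_image_sub_le_of_norm_hasDerivWithin_le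
    (f := B s) (f' := B' s) (C := |M| * |θ s - s.1|)
    (fun y hy => (H hs (hmem y hy)).1.hasDerivWithinAt)
    (fun y hy => ((H hs (hmem y hy)).2).trans (mul_le_mul (le_abs_self M)
      (Set.abs_sub_left_of_mem_uIcc hy) (abs_nonneg _) (abs_nonneg _)))
    Set.left_mem_uIcc Set.right_mem_uIcc
  rw [norm_pow, sq, ← mul_assoc]
  exact this

end Asymptotics

/-! ### The moving frame `radial`, `tangential`, `e 2`. -/

section Frame

variable (e : OrthonormalBasis (Fin 3) ℝ E3)

theorem hasDerivAt_radial (t : ℝ) : HasDerivAt (radial e) (tangential e t) t :=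
  ((Real.hasDerivAt_cos t).smul_const (e 0)).add ((Real.hasDerivAt_sin t).smul_const (e 1))

theorem hasDerivAt_tangential (t : ℝ) : HasDerivAt (tangential e) (-radial e t) t := by
  refine (((Real.hasDerivAt_sin t).neg.smul_const (e 0)).add
    ((Real.hasDerivAt_cos t).smul_const (e 1))).congr_deriv ?_
  simp only [radial]
  module

theorem contDiff_radial {n : WithTop ℕ∞} : ContDiff ℝ n (radial e) := by
  unfold radial
  fun_prop

theorem contDiff_tangential {n : WithTop ℕ∞} : ContDiff ℝ n (tangential e) := by
  unfold tangential
  fun_prop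

@[simp] theorem radial_zero : radial e 0 = e 0 := by simp [radial]

@[simp] theorem tangential_zero : tangential e 0 = e 1 := by simp [tangential]

theorem inner_radial_radial (s t : ℝ) :
    inner ℝ (radial e s) (radial e t) = Real.cos (s - t) := by
  simp [radial, inner_add_left, inner_add_right, inner_smul_left, inner_smul_right,
    e.inner_eq_ite, Real.cos_sub]
  ring

theorem inner_tangential_tangential (s t : ℝ) :
    inner ℝ (tangential e s) (tangential e t) = Real.cos (s - t) := by
  simp [tangential, inner_add_left, inner_add_right, inner_smul_left, inner_smul_right,
    e.inner_eq_ite, Real.cos_sub]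
  ring

theorem inner_radial_tangential (s t : ℝ) :
    inner ℝ (radial e s) (tangential e t) = Real.sin (s - t) := by
  simp [radial, tangential, inner_add_left, inner_add_right, inner_smul_left, inner_smul_right,
    e.inner_eq_ite, Real.sin_sub]
  ring

theorem inner_tangential_radial (s t : ℝ) :
    inner ℝ (tangential e s) (radial e t) = Real.sin (t - s) := by
  rw [real_inner_comm, inner_radial_tangential]

@[simp] theorem inner_radial_axis (t : ℝ) : inner ℝ (radial e t) (e 2) = 0 := by
  simp [radial, inner_add_left, inner_smul_left, e.inner_eq_ite]

@[simp] theorem inner_tangential_axis (t : ℝ) : inner ℝ (tangential e t) (e 2) = 0 := by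
  simp [tangential, inner_add_left, inner_smul_left, e.inner_eq_ite]

@[simp] theorem inner_axis_radial (t : ℝ) : inner ℝ (e 2) (radial e t) = 0 := by
  rw [real_inner_comm, inner_radial_axis]

@[simp] theorem inner_axis_tangential (t : ℝ) : inner ℝ (e 2) (tangential e t) = 0 := by
  rw [real_inner_comm, inner_tangential_axis]

theorem norm_radial (t : ℝ) : ‖radial e t‖ = 1 := by
  rw [norm_eq_sqrt_real_inner, inner_radial_radial]
  simp

theorem norm_tangential (t : ℝ) : ‖tangential e t‖ = 1 := by
  rw [norm_eq_sqrt_real_inner, inner_tangential_tangential]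
  simp

theorem frame_expansion (t : ℝ) (x : E3) :
    x = inner ℝ (radial e t) x • radial e t + inner ℝ (tangential e t) x • tangential e t
      + inner ℝ (e 2) x • e 2 := by
  nth_rw 1 [← e.sum_repr' x]
  have h := Real.sin_sq_add_cos_sq t
  simp only [Fin.sum_univ_three, radial, tangential, inner_add_left, inner_smul_left, neg_smul,
    inner_neg_left]
  simp only [conj_trivial]
  linear_combination (norm := module) (-h) • (inner ℝ (e 0) x • e 0 + inner ℝ (e 1) x • e 1)

/-- The components of a function in the moving frame, to leading order. -/
theorem isLittleO_of_components {α β : ℝ → ℝ} {A B : ℝ} {x : ℝ → E3}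
    (hx : ∀ᶠ t in 𝓝 0, x t = -(α t) • radial e t - β t • tangential e t)
    (hα : (fun t => α t - A * t ^ 3) =o[𝓝 0] (fun t : ℝ => t ^ 3))
    (hβ : (fun t => β t - B * t ^ 2) =o[𝓝 0] (fun t : ℝ => t ^ 2)) :
    (fun t => ‖x t‖ - |B| * t ^ 2) =o[𝓝 0] (fun t : ℝ => t ^ 2) ∧
    (fun t => |inner ℝ (radial e t) (x t)| - |A| * |t| ^ 3) =o[𝓝 0] (fun t : ℝ => t ^ 3) := by
  constructor
  -- The radial component is of third order, hence the tangential one alone determines the norm up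
  -- to `o(t²)`.
  · have hα2 : α =o[𝓝 0] (fun t : ℝ => t ^ 2) := by
      have h3 : (fun t : ℝ => t ^ 3) =o[𝓝 0] (fun t : ℝ => t ^ 2) :=
        isLittleO_pow_pow (by norm_num)
      have := (hα.trans h3).add (h3.const_mul_left A)
      simpa using this
    have hR : (fun t => radial e t) =O[𝓝 0] (fun _ => (1 : ℝ)) :=
      IsBigO.of_bound 1 (Eventually.of_forall fun t => by simp [norm_radial])
    have hT : (fun t => tangential e t) =O[𝓝 0] (fun _ => (1 : ℝ)) :=
      IsBigO.of_bound 1 (Eventually.of_forall fun t => by simp [norm_tangential])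
    have hd : (fun t => x t - (-(B * t ^ 2)) • tangential e t) =o[𝓝 0] (fun t : ℝ => t ^ 2) := by
      have h1 := hα2.smul_isBigO hR
      have h2 := hβ.smul_isBigO hT
      simp only [smul_eq_mul, mul_one] at h1 h2
      refine (h1.add h2).neg_left.congr' ?_ EventuallyEq.rfl
      filter_upwards [hx] with t ht
      rw [ht]
      module
    refine (isLittleO_norm_sub_norm hd).congr_left fun t => ?_
    rw [norm_smul, norm_tangential, mul_one, norm_neg, Real.norm_eq_abs, abs_mul,
      abs_of_nonneg (sq_nonneg t)]
  · have := isLittleO_norm_sub_norm hα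
    refine this.congr' ?_ EventuallyEq.rfl
    filter_upwards [hx] with t ht
    rw [ht, inner_sub_right, inner_smul_right, inner_smul_right, inner_radial_radial,
      inner_radial_tangential]
    simp

end Frame

/-! ### Envelopes of planes and their second order contact. -/

section Envelope

theorem ContDiffAt.deriv_of_succ {E : Type*} [NormedAddCommGroup E] [NormedSpace ℝ E]
    {n : WithTop ℕ∞} {f : ℝ → E} {t : ℝ} (hf : ContDiffAt ℝ (n + 1) f t) :
    ContDiffAt ℝ n (deriv f) t := by
  have := (hf.fderiv_right_succ).clm_apply (contDiffAt_const (c := (1 : ℝ)))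
  simpa using this

theorem ContDiffAt.eventually_differentiableAt_deriv {φ : ℝ → ℝ} {t₀ : ℝ}
    (hφ : ContDiffAt ℝ 2 φ t₀) :
    (∀ᶠ t in 𝓝 t₀, DifferentiableAt ℝ φ t ∧ DifferentiableAt ℝ (deriv φ) t) ∧
      ContinuousAt (deriv (deriv φ)) t₀ := by
  refine ⟨?_, (ContDiffAt.deriv_of_succ (n := 0)
    (ContDiffAt.deriv_of_succ (n := 1) hφ)).continuousAt⟩
  filter_upwards [hφ.eventually (by simp)] with t ht
  exact ⟨ht.differentiableAt (by simp),
    (ContDiffAt.deriv_of_succ (n := 1) ht).differentiableAt (by simp)⟩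

open RuledSurface

variable {J J₁ J₂ : Set ℝ} {o : E3} {e : OrthonormalBasis (Fin 3) ℝ E3}
  {h g h₁ g₁ h₂ g₂ : ℝ → ℝ}

theorem envelope_pt (q : ℝ × ℝ) : (envelope J o e h g).pt q =
    o - (h q.1 + q.2 * g q.1) • radial e q.1
      - (deriv h q.1 + q.2 * deriv g q.1) • tangential e q.1 + q.2 • e 2 := by
  simp only [pt, envelope]
  module

theorem envelope_pt_sub (q : ℝ × ℝ) :
    (envelope J₁ o e h₁ g₁).pt q - (envelope J₂ o e h₂ g₂).pt q =
    -((h₁ q.1 - h₂ q.1) + q.2 * (g₁ q.1 - g₂ q.1)) • radial e q.1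
      - ((deriv h₁ q.1 - deriv h₂ q.1) + q.2 * (deriv g₁ q.1 - deriv g₂ q.1)) •
        tangential e q.1 := by
  simp only [envelope_pt]
  module

/-- The two radial terms `H₁ • radial` cancel, so the velocity is tangential and its size is the
radius of curvature. It applies to every horizontal section of an envelope, with the support
function `h + z g` at height `z`. -/
theorem hasDerivAt_support_curve {H H₁ : ℝ → ℝ} {H₂ t : ℝ} (h0 : HasDerivAt H (H₁ t) t)
    (h1 : HasDerivAt H₁ H₂ t) :
    HasDerivAt (fun s => -(H s) • radial e s - H₁ s • tangential e s)
      (-(H t + H₂) • tangential e t) t := by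
  refine ((h0.neg.smul (hasDerivAt_radial e t)).sub
    (h1.smul (hasDerivAt_tangential e t))).congr_deriv ?_
  simp only [Pi.neg_apply]
  module

theorem hasDerivAt_envelope_pt {t z : ℝ} (hh : DifferentiableAt ℝ h t)
    (hh' : DifferentiableAt ℝ (deriv h) t) (hg : DifferentiableAt ℝ g t)
    (hg' : DifferentiableAt ℝ (deriv g) t) :
    HasDerivAt (fun s => (envelope J o e h g).pt (s, z))
      (-(h t + deriv (deriv h) t + z * (g t + deriv (deriv g) t)) • tangential e t) t := by
  have := ((hasDerivAt_support_curve (e := e)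
    (H := fun s => h s + z * g s) (H₁ := fun s => deriv h s + z * deriv g s)
    (hh.hasDerivAt.add (hg.hasDerivAt.const_mul z))
    (hh'.hasDerivAt.add (hg'.hasDerivAt.const_mul z))).const_add (o + z • e 2))
  refine (this.congr_deriv ?_).congr_of_eventuallyEq (Eventually.of_forall fun s => ?_)
  · module
  · simp only [envelope_pt]
    module

theorem inner_axis_envelope_pt (q : ℝ × ℝ) :
    inner ℝ (e 2) ((envelope J o e h g).pt q) = inner ℝ (e 2) o + q.2 := by
  simp [envelope_pt, inner_add_right, inner_sub_right, inner_smul_right]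

/-- Ruled surfaces which envelope planes whose coordinates agree to second order. -/
theorem envelope_infDist_isLittleO {w : ℝ}
    (hh₂ : ContDiffAt ℝ 2 h₂ 0) (hg₂ : ContDiffAt ℝ 2 g₂ 0)
    (hh : (fun t => h₁ t - h₂ t) =o[𝓝 0] (fun t : ℝ => t ^ 2))
    (hh' : (fun t => deriv h₁ t - deriv h₂ t) =o[𝓝 0] (fun t : ℝ => t))
    (hg : (fun t => g₁ t - g₂ t) =o[𝓝 0] (fun t : ℝ => t ^ 2))
    (hg' : (fun t => deriv g₁ t - deriv g₂ t) =o[𝓝 0] (fun t : ℝ => t))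
    (hreg : h₂ 0 + deriv (deriv h₂) 0 + w * (g₂ 0 + deriv (deriv g₂) 0) ≠ 0)
    {V : Set (ℝ × ℝ)} (hV : V ∈ 𝓝 (0, w)) :
    (fun s => Metric.infDist ((envelope J₁ o e h₁ g₁).pt s) ((envelope J₂ o e h₂ g₂).pt '' V))
      =o[𝓝 (0, w)] (fun s => s.1 ^ 2) := by
  set X := (envelope J₁ o e h₁ g₁).pt with hX
  set Y := (envelope J₂ o e h₂ g₂).pt with hY
  obtain ⟨hdh, hch⟩ := hh₂.eventually_differentiableAt_deriv
  obtain ⟨hdg, hcg⟩ := hg₂.eventually_differentiableAt_deriv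
  set Λ : ℝ → ℝ → ℝ := fun t z => h₂ t + deriv (deriv h₂) t + z * (g₂ t + deriv (deriv g₂) t)
    with hΛ
  have hq2 : Tendsto (fun q : (ℝ × ℝ) × ℝ => q.2) (𝓝 ((0, w), 0)) (𝓝 0) :=
    continuous_snd.tendsto ((((0 : ℝ), w), (0 : ℝ)) : (ℝ × ℝ) × ℝ)
  have hq1 : Tendsto (fun q : (ℝ × ℝ) × ℝ => q.1.1) (𝓝 ((0, w), 0)) (𝓝 0) :=
    (continuous_fst.comp continuous_fst).tendsto ((((0 : ℝ), w), (0 : ℝ)) : (ℝ × ℝ) × ℝ)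
  have hq3 : Tendsto (fun q : (ℝ × ℝ) × ℝ => q.1.2) (𝓝 ((0, w), 0)) (𝓝 w) :=
    (continuous_snd.comp continuous_fst).tendsto ((((0 : ℝ), w), (0 : ℝ)) : (ℝ × ℝ) × ℝ)
  have hs1 : Tendsto (fun s : ℝ × ℝ => s.1) (𝓝 (0, w)) (𝓝 0) :=
    continuous_fst.tendsto ((0 : ℝ), w)
  have hs2 : Tendsto (fun s : ℝ × ℝ => s.2) (𝓝 (0, w)) (𝓝 w) :=
    continuous_snd.tendsto ((0 : ℝ), w)
  have hΛc : Tendsto (fun q : (ℝ × ℝ) × ℝ => Λ q.2 q.1.2) (𝓝 ((0, w), 0)) (𝓝 (Λ 0 w)) :=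
    ((hh₂.continuousAt.tendsto.comp hq2).add (hch.tendsto.comp hq2)).add
      (hq3.mul ((hg₂.continuousAt.tendsto.comp hq2).add (hcg.tendsto.comp hq2)))
  have hYd : ∀ᶠ q : (ℝ × ℝ) × ℝ in 𝓝 ((0, w), 0),
      HasDerivAt (fun t => Y (t, q.1.2)) (-(Λ q.2 q.1.2) • tangential e q.2) q.2 := by
    filter_upwards [hq2.eventually (hdh.and hdg)] with q hq
    exact hasDerivAt_envelope_pt hq.1.1 hq.1.2 hq.2.1 hq.2.2
  have hAs : ∀ s : ℝ × ℝ, inner ℝ (tangential e s.1) (Y (s.1, s.2) - X s) =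
      (deriv h₁ s.1 - deriv h₂ s.1) + s.2 * (deriv g₁ s.1 - deriv g₂ s.1) := fun s => by
    rw [← neg_sub, inner_neg_right, hX, hY, envelope_pt_sub, inner_sub_right, inner_smul_right,
      inner_smul_right, inner_tangential_radial, inner_tangential_tangential]
    simp
  have hBs : ∀ s : ℝ × ℝ, inner ℝ (radial e s.1) (Y (s.1, s.2) - X s) =
      (h₁ s.1 - h₂ s.1) + s.2 * (g₁ s.1 - g₂ s.1) := fun s => by
    rw [← neg_sub, inner_neg_right, hX, hY, envelope_pt_sub, inner_sub_right, inner_smul_right,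
      inner_smul_right, inner_radial_radial, inner_radial_tangential]
    simp
  have hbdd : (fun s : ℝ × ℝ => s.2) =O[𝓝 (0, w)] (fun _ => (1 : ℝ)) := hs2.isBigO_one ℝ
  have hA0 : (fun s : ℝ × ℝ => inner ℝ (tangential e s.1) (Y (s.1, s.2) - X s))
      =o[𝓝 (0, w)] (fun s => s.1) := by
    simp only [hAs]
    have := hbdd.mul_isLittleO (hg'.comp_tendsto hs1)
    simp only [one_mul] at this
    exact (hh'.comp_tendsto hs1).add this
  have hB0 : (fun s : ℝ × ℝ => inner ℝ (radial e s.1) (Y (s.1, s.2) - X s))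
      =o[𝓝 (0, w)] (fun s => s.1 ^ 2) := by
    simp only [hBs]
    have := hbdd.mul_isLittleO (hg.comp_tendsto hs1)
    simp only [one_mul] at this
    exact (hh.comp_tendsto hs1).add this
  -- `θ s` is the parameter at which the section of `Y` at the height of `X s` meets the line
  -- through `X s` in direction `radial e s.1`. Regularity of `Y` at `(0, w)` is the nonvanishing of
  -- `c`.
  obtain ⟨θ, hθ0, hθA, hθO⟩ := exists_root_near (w := w) (c := -Λ 0 w)
    (A := fun s t => inner ℝ (tangential e s.1) (Y (t, s.2) - X s))
    (A' := fun s t => -Λ t s.2 * Real.cos (s.1 - t)) (neg_ne_zero.2 hreg)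
    (hYd.mono fun q hq => by
      refine ((hasDerivAt_const q.2 (tangential e q.1.1)).inner ℝ
        (hq.sub_const (X q.1))).congr_deriv ?_
      rw [inner_smul_right, inner_tangential_tangential, inner_zero_left, add_zero])
    (by
      have : Tendsto (fun q : (ℝ × ℝ) × ℝ => Real.cos (q.1.1 - q.2)) (𝓝 ((0, w), 0)) (𝓝 1) := by
        have h1 := (Real.continuous_cos.tendsto _).comp (hq1.sub hq2)
        rw [sub_zero, Real.cos_zero] at h1
        exact h1
      simpa using hΛc.neg.mul this)
    (hA0.trans_tendsto hs1)
  have hθo := hθO.trans_isLittleO hA0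
  -- The radial velocity is `-Λ sin(s.1 - t)`, which vanishes at `t = s.1`; any bound of `|Λ|` near
  -- the base point serves as `M`.
  have hB := isBigO_sq_of_deriv_bound (w := w) (M := |Λ 0 w| + 1)
    (B := fun s t => inner ℝ (radial e s.1) (Y (t, s.2) - X s))
    (B' := fun s t => -Λ t s.2 * Real.sin (s.1 - t)) (θ := θ)
    (by
      filter_upwards [hYd, hΛc.abs.eventually (gt_mem_nhds (lt_add_one _))] with q hq hq'
      constructor
      · refine ((hasDerivAt_const q.2 (radial e q.1.1)).inner ℝ
          (hq.sub_const (X q.1))).congr_deriv ?_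
        rw [inner_smul_right, inner_radial_tangential, inner_zero_left, add_zero]
      · rw [abs_mul, abs_neg, abs_sub_comm q.2]
        exact mul_le_mul hq'.le Real.abs_sin_le_abs (abs_nonneg _) (by positivity))
    hθ0
  have hBθ : (fun s => inner ℝ (radial e s.1) (Y (θ s, s.2) - X s)) =o[𝓝 (0, w)]
      (fun s => s.1 ^ 2) := by
    have := (hB.trans_isLittleO (hθo.pow (by norm_num : 0 < 2))).add hB0
    simpa using this
  have hVθ : ∀ᶠ s in 𝓝 ((0 : ℝ), w), (θ s, s.2) ∈ V := (hθ0.prodMk_nhds hs2).eventually hV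
  refine IsBigO.trans_isLittleO (IsBigO.of_bound 1 ?_) hBθ
  filter_upwards [hVθ, hθA] with s hsV hsA
  rw [Real.norm_of_nonneg Metric.infDist_nonneg, one_mul]
  refine (Metric.infDist_le_dist_of_mem (Set.mem_image_of_mem Y hsV)).trans ?_
  -- Heights agree and `θ` kills the tangential component, so the distance is the absolute value of
  -- the radial component.
  have hz : inner ℝ (e 2) (Y (θ s, s.2) - X s) = 0 := by
    rw [inner_sub_right, hX, hY, inner_axis_envelope_pt, inner_axis_envelope_pt, sub_self]
  have hx := frame_expansion e s.1 (Y (θ s, s.2) - X s)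
  rw [hsA, hz, zero_smul, zero_smul, add_zero, add_zero] at hx
  rw [dist_comm, dist_eq_norm]
  refine (congrArg norm hx).le.trans ?_
  rw [norm_smul, norm_radial, mul_one]

end Envelope

/-! ### Changes of parameters and regular points. -/

section Reparametrization

/-- The inverse function theorem on an interval small enough that `deriv τ` stays nonzero along the
inverse. It serves to pass from `u` to the tangent angle. -/
theorem exists_contDiffOn_local_inverse {k : WithTop ℕ∞} (hk : 1 ≤ k) {τ : ℝ → ℝ} {U : Set ℝ}
    {u₀ : ℝ} (hU : IsOpen U) (hu₀ : u₀ ∈ U) (hτ : ContDiffOn ℝ k τ U) (h0 : τ u₀ = 0)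
    (hd : deriv τ u₀ ≠ 0) :
    ∃ μ : ℝ → ℝ, ∃ ε > 0, ContDiffOn ℝ k μ (Set.Ioo (-ε) ε) ∧ μ 0 = u₀ ∧
      (∀ t ∈ Set.Ioo (-ε) ε, μ t ∈ U ∧ τ (μ t) = t ∧ deriv τ (μ t) ≠ 0 ∧
        HasDerivAt μ (deriv τ (μ t))⁻¹ t) ∧
      ∀ᶠ u in 𝓝 u₀, μ (τ u) = u := by
  have hk0 : k ≠ 0 := (zero_lt_one.trans_le hk).ne'
  have hat : ∀ u ∈ U, ContDiffAt ℝ k τ u := fun u hu => hτ.contDiffAt (hU.mem_nhds hu)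
  have hstrict : HasStrictDerivAt τ (deriv τ u₀) u₀ := (hat u₀ hu₀).hasStrictDerivAt hk0
  set e := (hstrict.hasStrictFDerivAt_equiv hd).toOpenPartialHomeomorph τ with he
  have hecoe : (e : ℝ → ℝ) = τ := rfl
  have hsrc : u₀ ∈ e.source :=
    (hstrict.hasStrictFDerivAt_equiv hd).mem_toOpenPartialHomeomorph_source
  have htgt : (0 : ℝ) ∈ e.target := by
    have := e.map_source hsrc
    rwa [hecoe, h0] at this
  have hsymm0 : e.symm 0 = u₀ := by
    have := e.left_inv hsrc
    rwa [hecoe, h0] at this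
  have hcont : Tendsto e.symm (𝓝 0) (𝓝 u₀) := by
    have := e.symm.continuousAt htgt
    rwa [ContinuousAt, hsymm0] at this
  have hdc : ContinuousOn (deriv τ) U := hτ.continuousOn_deriv_of_isOpen hU hk
  have hev : ∀ᶠ t in 𝓝 (0 : ℝ), t ∈ e.target ∧ e.symm t ∈ U ∧ deriv τ (e.symm t) ≠ 0 := by
    filter_upwards [e.open_target.mem_nhds htgt, hcont.eventually (hU.mem_nhds hu₀),
      hcont.eventually ((hdc.continuousAt (hU.mem_nhds hu₀)).eventually_ne hd)] with t h1 h2 h3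
    exact ⟨h1, h2, h3⟩
  obtain ⟨ε, hε, H⟩ := Metric.eventually_nhds_iff_ball.1 hev
  rw [Real.ball_eq_Ioo, zero_sub, zero_add] at H
  have hder : ∀ t ∈ Set.Ioo (-ε) ε, HasDerivAt e (deriv τ (e.symm t)) (e.symm t) := fun t ht =>
    ((hat _ (H t ht).2.1).differentiableAt hk0).hasDerivAt
  refine ⟨e.symm, ε, hε, fun t ht => ?_, hsymm0, fun t ht => ⟨(H t ht).2.1, ?_, (H t ht).2.2, ?_⟩,
    ?_⟩
  · exact (e.contDiffAt_symm_deriv (H t ht).2.2 (H t ht).1 (hder t ht)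
      (hat _ (H t ht).2.1)).contDiffWithinAt
  · exact e.right_inv (H t ht).1
  · exact e.hasDerivAt_symm (H t ht).1 (H t ht).2.2 (hder t ht)
  · filter_upwards [e.open_source.mem_nhds hsrc] with u hu
    exact e.left_inv hu

namespace RuledSurface

variable {S : RuledSurface}

theorem hasDerivAt_pt_comp {μ ψ : ℝ → ℝ} {t m c : ℝ} (hb : DifferentiableAt ℝ S.base (μ t))
    (hr : DifferentiableAt ℝ S.dir (μ t)) (hμ : HasDerivAt μ m t) (hψ : HasDerivAt ψ c t) :
    HasDerivAt (fun s => S.pt (μ s, ψ s)) (m • S.du (μ t) (ψ t) + c • S.dir (μ t)) t := by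
  refine ((hb.hasDerivAt.scomp t hμ).add (hψ.smul (hr.hasDerivAt.scomp t hμ))).congr_deriv ?_
  simp only [du, Function.comp]
  module

theorem IsRegular.smul_du_add_ne_zero {u v m c : ℝ} (h : S.IsRegular u v) (hm : m ≠ 0) :
    m • S.du u v + c • S.dir u ≠ 0 := fun h0 =>
  hm ((LinearIndependent.pair_iff.1 h m c h0).1)

theorem IsNormalAt.inner_smul_du_add {u v m c : ℝ} {n : E3} (h : S.IsNormalAt u n) :
    inner ℝ n (m • S.du u v + c • S.dir u) = 0 := by
  rw [inner_add_right, inner_smul_right, inner_smul_right, h.1, h.2 v, mul_zero, mul_zero, add_zero]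

theorem IsNormalAt.inner_deriv_base {u : ℝ} {n : E3} (h : S.IsNormalAt u n) :
    inner ℝ n (deriv S.base u) = 0 := by
  simpa [du] using h.2 0

theorem IsNormalAt.inner_deriv_dir {u : ℝ} {n : E3} (h : S.IsNormalAt u n) :
    inner ℝ n (deriv S.dir u) = 0 := by
  have := h.2 1
  rwa [du, one_smul, inner_add_right, h.inner_deriv_base, zero_add] at this

theorem IsNormalAt.smul {u : ℝ} {n : E3} (h : S.IsNormalAt u n) (c : ℝ) :
    S.IsNormalAt u (c • n) :=
  ⟨by rw [inner_smul_left, h.1, mul_zero], fun v => by rw [inner_smul_left, h.2 v, mul_zero]⟩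

/-- At a regular point the differential of the parametrization is injective, hence bounded below,
and it dominates the remainder. Thus estimates in the parameters become estimates in the distance to
the contact point. -/
theorem IsRegular.isBigO_sub {u v : ℝ} (h : S.IsRegular u v) (hb : DifferentiableAt ℝ S.base u)
    (hr : DifferentiableAt ℝ S.dir u) :
    (fun s => s - (u, v)) =O[𝓝 (u, v)] fun s => S.pt s - S.pt (u, v) := by
  have hb' : HasFDerivAt (fun q : ℝ × ℝ => S.base q.1) _ (u, v) :=
    HasFDerivAt.comp (u, v) (g := S.base) (f := Prod.fst) hb.hasDerivAt.hasFDerivAt hasFDerivAt_fst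
  have hr' : HasFDerivAt (fun q : ℝ × ℝ => S.dir q.1) _ (u, v) :=
    HasFDerivAt.comp (u, v) (g := S.dir) (f := Prod.fst) hr.hasDerivAt.hasFDerivAt hasFDerivAt_fst
  have hF := hb'.add ((hasFDerivAt_snd (𝕜 := ℝ) (p := (u, v))).smul hr')
  set L : ℝ × ℝ →L[ℝ] E3 := _ with hL
  change HasFDerivAt _ L (u, v) at hF
  have hLap : ∀ z, L z = z.1 • S.du u v + z.2 • S.dir u := fun z => by
    simp [hL, du]
    module
  have hinj : Function.Injective L := by
    rw [injective_iff_map_eq_zero]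
    intro z hz
    rw [hLap] at hz
    obtain ⟨h1, h2⟩ := LinearIndependent.pair_iff.1 h _ _ hz
    exact Prod.ext h1 h2
  obtain ⟨K, -, hK⟩ := (LinearMap.injective_iff_antilipschitz (L : ℝ × ℝ →ₗ[ℝ] E3)).1 hinj
  have A : (fun z => z - (u, v)) =O[𝓝 (u, v)] fun z => L (z - (u, v)) :=
    IsBigO.of_bound K (Eventually.of_forall fun z => by simpa using hK.le_mul_dist (z - (u, v)) 0)
  have hequiv := hF.isLittleO.trans_isBigO A
  exact A.trans (IsEquivalent.isBigO_symm hequiv)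

theorem eventually_isRegular {u v : ℝ} (h : S.IsRegular u v) {μ ν : ℝ → ℝ} {t : ℝ}
    (hμ : ContinuousAt μ t) (hν : ContinuousAt ν t) (hut : μ t = u) (hvt : ν t = v)
    (hb : ContinuousAt (deriv S.base) u) (hr : ContinuousAt (deriv S.dir) u)
    (hd : ContinuousAt S.dir u) : ∀ᶠ s in 𝓝 t, S.IsRegular (μ s) (ν s) := by
  subst hut hvt
  have hc : ContinuousAt (fun s => ![S.du (μ s) (ν s), S.dir (μ s)]) t := by
    refine continuousAt_pi.2 fun i => ?_
    fin_cases i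
    · exact (hb.comp hμ).add (hν.smul (hr.comp hμ))
    · exact hd.comp hμ
  exact hc.eventually (isOpen_setOfPred_linearIndependent.mem_nhds h)

/-- Second order contact can be checked in a chart whose first coordinate vanishes on the ruling. -/
theorem secondOrderContact_of_chart {u₀ v : ℝ} {μ ν β τ : ℝ → ℝ} {X Y : ℝ × ℝ → E3}
    (hreg : S.IsRegular u₀ v) (hb : DifferentiableAt ℝ S.base u₀)
    (hr : DifferentiableAt ℝ S.dir u₀) (hτ : DifferentiableAt ℝ τ u₀) (hτ0 : τ u₀ = 0)
    (hμτ : ∀ᶠ u in 𝓝 u₀, μ (τ u) = u) (hν : ContinuousAt ν 0) (hβ : ContinuousAt β 0)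
    (hβ0 : β 0 ≠ 0)
    (hX : ∀ᶠ t in 𝓝 0, ∀ z, S.pt (μ t, ν t + β t * z) = X (t, z)) {w : ℝ}
    (hw : w = (v - ν 0) / β 0) (hXY : X (0, w) = Y (0, w))
    (h : ∀ V ∈ 𝓝 ((0 : ℝ), w), (fun s => Metric.infDist (X s) (Y '' V))
      =o[𝓝 (0, w)] (fun s => s.1 ^ 2)) :
    SecondOrderContact S.pt (u₀, v) Y (0, w) := by
  -- The inverse of the chart `(t, z) ↦ (μ t, ν t + β t * z)`.
  set ψ : ℝ × ℝ → ℝ × ℝ := fun q => (τ q.1, (q.2 - ν (τ q.1)) / β (τ q.1)) with hψ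
  have h1 : Tendsto (fun q : ℝ × ℝ => q.1) (𝓝 (u₀, v)) (𝓝 u₀) := continuous_fst.tendsto (u₀, v)
  have h2 : Tendsto (fun q : ℝ × ℝ => q.2) (𝓝 (u₀, v)) (𝓝 v) := continuous_snd.tendsto (u₀, v)
  have hτt : Tendsto (fun q : ℝ × ℝ => τ q.1) (𝓝 (u₀, v)) (𝓝 0) := by
    have := hτ.continuousAt.tendsto.comp h1
    rwa [hτ0] at this
  have hψt : Tendsto ψ (𝓝 (u₀, v)) (𝓝 (0, w)) := by
    rw [hw]
    exact hτt.prodMk_nhds ((h2.sub (hν.tendsto.comp hτt)).div (hβ.tendsto.comp hτt) hβ0)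
  have hSX : ∀ᶠ s in 𝓝 (u₀, v), S.pt s = X (ψ s) := by
    filter_upwards [h1.eventually hμτ, hτt.eventually hX,
      hτt.eventually (hβ.eventually_ne hβ0)] with s h3 h4 h5
    rw [← h4, h3, mul_div_cancel₀ _ h5, add_sub_cancel]
  have hψ0 : ψ (u₀, v) = (0, w) := by simp [hψ, hτ0, hw]
  refine ⟨by rw [hSX.self_of_nhds, hψ0, hXY], fun V hV => ?_⟩
  have h3 := (h V hV).comp_tendsto hψt
  have h4 : (fun s => Metric.infDist (S.pt s) (Y '' V)) =o[𝓝 (u₀, v)]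
      (fun s => (ψ s).1 ^ 2) :=
    h3.congr' (hSX.mono fun s hs => by simp [hs]) EventuallyEq.rfl
  -- The first coordinate vanishes on the ruling, so it is `O(u - u₀)`, hence bounded by a multiple
  -- of the distance in space.
  have h5 : (fun s => (ψ s).1) =O[𝓝 (u₀, v)] (fun s => S.pt s - S.pt (u₀, v)) := by
    have h6 := hτ.hasDerivAt.isBigO_sub.comp_tendsto h1
    simp only [hτ0, sub_zero, Function.comp_def] at h6
    have h7 : (fun s : ℝ × ℝ => s.1 - u₀) =O[𝓝 (u₀, v)] (fun s => s - (u₀, v)) :=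
      IsBigO.of_bound 1 (Eventually.of_forall fun s => by
        rw [one_mul]; exact norm_fst_le (s - (u₀, v)))
    exact (h6.trans h7).trans (hreg.isBigO_sub hb hr)
  exact h4.trans_isBigO (h5.norm_right.pow 2)

end RuledSurface

end Reparametrization

/-! ### Plane cross sections and rulings normalized by height. -/

namespace RuledSurface

section LevelCurve

variable (S : RuledSurface) (z p : E3)

/-- The factor which gives the ruling direction the height `1` in direction `z`. -/
noncomputable def heightScale (u : ℝ) : ℝ := (inner ℝ z (S.dir u))⁻¹

/-- The parameter on the ruling `u` of the point at the same height in direction `z` as `p`. -/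
noncomputable def levelParam (u : ℝ) : ℝ := inner ℝ z (p - S.base u) * S.heightScale z u

variable {S z p}

theorem levelParam_self {u₀ v₀ : ℝ} (h : inner ℝ z (S.dir u₀) ≠ 0) :
    S.levelParam z (S.pt (u₀, v₀)) u₀ = v₀ := by
  simp [levelParam, heightScale, pt, inner_smul_right, h]

theorem inner_pt_levelParam {u x : ℝ} (h : inner ℝ z (S.dir u) ≠ 0) :
    inner ℝ z (S.pt (u, S.levelParam z p u + S.heightScale z u * x)) = inner ℝ z p + x := by
  simp only [levelParam, heightScale, pt, inner_smul_right, inner_add_right, inner_sub_right]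
  field_simp
  ring

theorem inner_heightScale_smul_dir {u : ℝ} (h : inner ℝ z (S.dir u) ≠ 0) :
    inner ℝ z (S.heightScale z u • S.dir u) = 1 := by
  rw [heightScale, inner_smul_right, inv_mul_cancel₀ h]

theorem contDiffOn_heightScale {k : WithTop ℕ∞} {U : Set ℝ} (hr : ContDiffOn ℝ k S.dir U)
    (h : ∀ u ∈ U, inner ℝ z (S.dir u) ≠ 0) : ContDiffOn ℝ k (S.heightScale z) U :=
  (contDiffOn_const.inner ℝ hr).inv h

theorem contDiffOn_levelParam {k : WithTop ℕ∞} {U : Set ℝ} (hb : ContDiffOn ℝ k S.base U)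
    (hr : ContDiffOn ℝ k S.dir U) (h : ∀ u ∈ U, inner ℝ z (S.dir u) ≠ 0) :
    ContDiffOn ℝ k (S.levelParam z p) U :=
  (contDiffOn_const.inner ℝ (contDiffOn_const.sub hb)).mul (contDiffOn_heightScale hr h)

theorem pt_add (u v w : ℝ) : S.pt (u, v + w) = S.pt (u, v) + w • S.dir u := by
  simp only [pt]
  module

end LevelCurve

end RuledSurface

/-! ### Inflection rulings and approximating cylinders. -/

section Cylinder

/-- From `⟪N, c'⟫ = 0` follows `⟪e₀, c'⟫ = -⟪N - e₀, c'⟫`, which is `o(t)` because `N` is stationary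
and `c'` bounded; integration gives one more power. It is applied to the cross section and to the
ruling direction. -/
theorem isLittleO_inner_of_normal {N c c' : ℝ → E3} {e₀ : E3} (hN0 : N 0 = e₀)
    (hN : HasDerivAt N 0 0) (hc0 : inner ℝ e₀ (c 0) = 0) (hc : ∀ᶠ t in 𝓝 0, HasDerivAt c (c' t) t)
    (hc' : ContinuousAt c' 0) (hNc : ∀ᶠ t in 𝓝 0, inner ℝ (N t) (c' t) = 0) :
    (fun t => inner ℝ e₀ (c t)) =o[𝓝 0] (fun t : ℝ => t ^ 2) := by
  refine isLittleO_pow_succ_of_hasDerivAt (n := 1) (F' := fun t => inner ℝ e₀ (c' t)) hc0 ?_ ?_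
  · filter_upwards [hc] with t ht
    exact ((hasDerivAt_const t e₀).inner ℝ ht).congr_deriv (by simp)
  · have h1 : (fun t => N t - N 0) =o[𝓝 0] (fun t : ℝ => t) := by simpa using hN.isLittleO
    have h2 : (fun t => inner ℝ (N t - N 0) (c' t)) =o[𝓝 0] (fun t : ℝ => t ^ 1) := by
      refine IsBigO.trans_isLittleO (g := fun t => ‖N t - N 0‖ * ‖c' t‖)
        (IsBigO.of_bound 1 (Eventually.of_forall fun t => ?_)) ?_
      · simpa using norm_inner_le_norm (𝕜 := ℝ) (N t - N 0) (c' t)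
      · simpa using h1.norm_left.mul_isBigO (hc'.tendsto.norm.isBigO_one ℝ)
    refine h2.neg_left.congr' ?_ EventuallyEq.rfl
    filter_upwards [hNc] with t ht
    rw [inner_sub_left, ht, hN0]
    ring

/-- A ruled surface with stationary normal `e 0` along the ruling `t = 0` is approximated by the
cylinder through a cross section. -/
theorem cylinder_infDist_isLittleO {e : OrthonormalBasis (Fin 3) ℝ E3} {p : E3}
    {N a a' R R' : ℝ → E3} (hN0 : N 0 = e 0) (hN : HasDerivAt N 0 0)
    (ha : ∀ᶠ t in 𝓝 0, HasDerivAt a (a' t) t) (ha' : ContinuousAt a' 0)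
    (hR : ∀ᶠ t in 𝓝 0, HasDerivAt R (R' t) t) (hR' : ContinuousAt R' 0)
    (hNa : ∀ᶠ t in 𝓝 0, inner ℝ (N t) (a' t) = 0) (hNR : ∀ᶠ t in 𝓝 0, inner ℝ (N t) (R' t) = 0)
    (hR2 : ∀ᶠ t in 𝓝 0, inner ℝ (e 2) (R t) = 1)
    (ha2 : ∀ᶠ t in 𝓝 0, inner ℝ (e 2) (a t) = inner ℝ (e 2) p) (ha0 : a 0 = p) (hR0 : R 0 = e 2)
    (hreg : inner ℝ (e 1) (a' 0) ≠ 0) {w : ℝ} {V : Set (ℝ × ℝ)} (hV : V ∈ 𝓝 (0, w)) :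
    (fun s : ℝ × ℝ => Metric.infDist (a s.1 + s.2 • R s.1)
      ((fun s : ℝ × ℝ => a s.1 + s.2 • e 2) '' V)) =o[𝓝 (0, w)] (fun s => s.1 ^ 2) := by
  have hα := isLittleO_inner_of_normal (c := fun t => a t - p) hN0 hN (by simp [ha0])
    (ha.mono fun t ht => ht.sub_const p) ha' hNa
  have hγ := isLittleO_inner_of_normal hN0 hN (by simp [hR0, e.inner_eq_ite]) hR hR' hNR
  have hq2 : Tendsto (fun q : (ℝ × ℝ) × ℝ => q.2) (𝓝 ((0, w), 0)) (𝓝 0) :=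
    continuous_snd.tendsto ((((0 : ℝ), w), (0 : ℝ)) : (ℝ × ℝ) × ℝ)
  have hs1 : Tendsto (fun s : ℝ × ℝ => s.1) (𝓝 (0, w)) (𝓝 0) :=
    continuous_fst.tendsto ((0 : ℝ), w)
  have hs2 : Tendsto (fun s : ℝ × ℝ => s.2) (𝓝 (0, w)) (𝓝 w) :=
    continuous_snd.tendsto ((0 : ℝ), w)
  have hbdd : (fun s : ℝ × ℝ => s.2) =O[𝓝 (0, w)] (fun _ => (1 : ℝ)) := hs2.isBigO_one ℝ
  -- Rulings of `S` may turn inside the tangent plane at first order, so this is only `O(t)`, not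
  -- `o(t)` as for envelopes. It suffices, since it gives `θ = O(t)` and all normal components are
  -- `o(t²)`.
  have hA0 : (fun s : ℝ × ℝ => inner ℝ (e 1) (a s.1 + s.2 • e 2 - (a s.1 + s.2 • R s.1)))
      =O[𝓝 (0, w)] (fun s => s.1) := by
    have h1 : HasDerivAt (fun t => inner ℝ (e 1) (R t)) (inner ℝ (e 1) (R' 0)) 0 :=
      ((hasDerivAt_const 0 (e 1)).inner ℝ hR.self_of_nhds).congr_deriv (by simp)
    have h2 : (fun t => inner ℝ (e 1) (R t)) =O[𝓝 0] (fun t : ℝ => t) := by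
      simpa [hR0, e.inner_eq_ite] using h1.isBigO_sub
    have h3 := (hbdd.mul (h2.comp_tendsto hs1)).neg_left
    simp only [one_mul, Function.comp_def] at h3
    refine h3.congr_left fun s => ?_
    simp [inner_sub_right, inner_smul_right, e.inner_eq_ite]
  obtain ⟨θ, hθ0, hθA, hθO⟩ := exists_root_near (w := w) (c := inner ℝ (e 1) (a' 0))
    (A := fun s t => inner ℝ (e 1) (a t + s.2 • e 2 - (a s.1 + s.2 • R s.1)))
    (A' := fun _ t => inner ℝ (e 1) (a' t)) hreg
    (by
      filter_upwards [hq2.eventually ha] with q hq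
      exact ((hasDerivAt_const q.2 (e 1)).inner ℝ
        ((hq.add_const (q.1.2 • e 2)).sub_const (a q.1.1 + q.1.2 • R q.1.1))).congr_deriv (by simp))
    ((tendsto_const_nhds.inner ha'.tendsto).comp hq2)
    (hA0.trans_tendsto hs1)
  have hθ1 : θ =O[𝓝 (0, w)] (fun s => s.1) := by
    simpa using (hθO.trans hA0).add (isBigO_refl (fun s : ℝ × ℝ => s.1) _)
  have hB : (fun s : ℝ × ℝ => inner ℝ (e 0) (a (θ s) + s.2 • e 2 - (a s.1 + s.2 • R s.1)))
      =o[𝓝 (0, w)] (fun s => s.1 ^ 2) := by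
    have h1 := (hα.comp_tendsto hθ0).trans_isBigO (hθ1.pow 2)
    have h2 := hα.comp_tendsto hs1
    have h3 := hbdd.mul_isLittleO (hγ.comp_tendsto hs1)
    simp only [one_mul, Function.comp_def] at h1 h2 h3
    refine ((h1.sub h2).sub h3).congr_left fun s => ?_
    simp [inner_add_right, inner_sub_right, inner_smul_right, e.inner_eq_ite]
    ring
  have hVθ : ∀ᶠ s in 𝓝 ((0 : ℝ), w), (θ s, s.2) ∈ V := (hθ0.prodMk_nhds hs2).eventually hV
  refine IsBigO.trans_isLittleO (IsBigO.of_bound 1 ?_) hB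
  filter_upwards [hVθ, hθA, hs1.eventually hR2, hs1.eventually ha2, hθ0.eventually ha2]
    with s hsV hsA hsR hsa hsθ
  rw [Real.norm_of_nonneg Metric.infDist_nonneg, one_mul]
  refine (Metric.infDist_le_dist_of_mem (Set.mem_image_of_mem _ hsV)).trans ?_
  have hz : inner ℝ (e 2) (a (θ s) + s.2 • e 2 - (a s.1 + s.2 • R s.1)) = 0 := by
    simp [inner_add_right, inner_sub_right, inner_smul_right, hsR, hsa, hsθ]
  have hx := frame_expansion e 0 (a (θ s) + s.2 • e 2 - (a s.1 + s.2 • R s.1))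
  rw [tangential_zero, radial_zero, hsA, hz, zero_smul, zero_smul, add_zero, add_zero] at hx
  rw [dist_comm, dist_eq_norm]
  refine (congrArg norm hx).le.trans ?_
  rw [norm_smul, e.norm_eq_one, mul_one]

end Cylinder

theorem inner_deriv_eq_zero_of_eventually_const {c : ℝ → E3} {c' z : E3} {t x : ℝ}
    (hc : HasDerivAt c c' t) (h : ∀ᶠ s in 𝓝 t, inner ℝ z (c s) = x) : inner ℝ z c' = 0 := by
  have h1 := (hasDerivAt_const t z).inner ℝ hc
  rw [inner_zero_left, add_zero] at h1
  exact h1.unique ((hasDerivAt_const t x).congr_of_eventuallyEq h)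

/-- Two orthonormal vectors as first and third vector of an orthonormal basis. -/
theorem exists_orthonormalBasis_of_pair {x y : E3} (hx : ‖x‖ = 1) (hy : ‖y‖ = 1)
    (hxy : inner ℝ x y = 0) : ∃ e : OrthonormalBasis (Fin 3) ℝ E3, e 0 = x ∧ e 2 = y := by
  -- The middle entry is a dummy: only the indices `0` and `2` are prescribed.
  have hv : Orthonormal ℝ (Set.domRestrict ({0, 2} : Set (Fin 3)) ![x, 0, y]) := by
    constructor
    · rintro ⟨i, rfl | rfl⟩ <;> simp [Set.domRestrict, hx, hy]
    · rintro ⟨i, rfl | rfl⟩ ⟨j, rfl | rfl⟩ hij <;>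
        simp_all [Set.domRestrict, real_inner_comm]
  obtain ⟨e, he⟩ := hv.exists_orthonormalBasis_extension_of_card_eq (by simp)
  exact ⟨e, by simpa using he 0 (by simp), by simpa using he 2 (by simp)⟩

namespace RuledSurface

/-- Along an inflection ruling, the cylinder over a planar cross section has second order contact. -/
theorem exists_cylinder_contact {k : ℕ∞} (hk : 1 ≤ k) {S : RuledSurface} (hS : S.IsDevelopable k)
    {u₀ v₀ : ℝ} (hu₀ : u₀ ∈ S.dom) (hreg : S.IsRegular u₀ v₀) {n : ℝ → E3} {J : Set ℝ}
    (hJ : J ∈ 𝓝 u₀) (hn : ContDiffOn ℝ k n J) (hnJ : S.IsUnitNormalOn n J)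
    (hn0 : HasDerivAt n 0 u₀) :
    ∃ (Γ : RuledSurface) (μ ν : ℝ → ℝ),
      Γ.IsDevelopable k ∧ Γ.HasPlanarGaussImage ∧
      (0 : ℝ) ∈ Γ.dom ∧ μ 0 = u₀ ∧ ν 0 = v₀ ∧
      ContDiffOn ℝ k μ Γ.dom ∧ ContDiffOn ℝ k ν Γ.dom ∧
      (∀ t ∈ Γ.dom, μ t ∈ S.dom ∧ deriv μ t ≠ 0 ∧ S.IsRegular (μ t) (ν t) ∧
        Γ.IsRegular t 0 ∧ Γ.pt (t, 0) = S.pt (μ t, ν t)) ∧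
      (∀ v : ℝ, S.IsRegular u₀ v →
        ∃ w : ℝ, Γ.IsRegular 0 w ∧ SecondOrderContact S.pt (u₀, v) Γ.pt (0, w)) := by
  have hk1 : (1 : WithTop ℕ∞) ≤ k := by exact_mod_cast hk
  have hk0 : (k : WithTop ℕ∞) ≠ 0 := (zero_lt_one.trans_le hk1).ne'
  have hrn : ‖S.dir u₀‖ ≠ 0 := norm_ne_zero_iff.2 (hS.dir_ne_zero u₀ hu₀)
  obtain ⟨hn1, hn2⟩ := hnJ u₀ (mem_of_mem_nhds hJ)
  obtain ⟨e, he0, he2⟩ : ∃ e : OrthonormalBasis (Fin 3) ℝ E3,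
      e 0 = n u₀ ∧ e 2 = ‖S.dir u₀‖⁻¹ • S.dir u₀ :=
    exists_orthonormalBasis_of_pair hn1 (by rw [norm_smul, norm_inv, norm_norm, inv_mul_cancel₀ hrn])
      (by rw [inner_smul_right, hn2.1, mul_zero])
  have hdir0 : S.dir u₀ = ‖S.dir u₀‖ • e 2 := by
    rw [he2, smul_smul, mul_inv_cancel₀ hrn, one_smul]
  have hin0 : inner ℝ (e 2) (S.dir u₀) = ‖S.dir u₀‖ := by
    rw [hdir0, inner_smul_right, norm_smul]
    simp
  have hSnhds := hS.isOpen_dom.mem_nhds hu₀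
  have hdirC := (hS.contDiffOn_dir.contDiffAt hSnhds).continuousAt
  have hnC : ContinuousAt n u₀ := hn0.continuousAt
  have hU : ∃ δ > 0, ∀ u ∈ Metric.ball u₀ δ, u ∈ S.dom ∧ u ∈ J ∧ inner ℝ (e 2) (S.dir u) ≠ 0 ∧
      n u - inner ℝ (e 2) (n u) • e 2 ≠ 0 := by
    refine Metric.eventually_nhds_iff_ball.1 (Eventually.and hSnhds (Eventually.and hJ
      (Eventually.and ?_ ?_)))
    · exact (continuousAt_const.inner hdirC).eventually_ne (by rwa [hin0])
    · refine (hnC.sub ((ContinuousAt.inner (𝕜 := ℝ) continuousAt_const hnC).smul continuousAt_const)).eventually_ne ?_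
      simp only [Pi.sub_apply, Pi.smul_apply', ← he0]
      rw [← norm_ne_zero_iff]
      simp [e.inner_eq_ite]
  obtain ⟨δ, hδ, H⟩ := hU
  set U := Metric.ball u₀ δ with hUdef
  have hUo : IsOpen U := Metric.isOpen_ball
  have huU : u₀ ∈ U := Metric.mem_ball_self hδ
  have hbU := hS.contDiffOn_base.mono fun u hu => (H u hu).1
  have hrU := hS.contDiffOn_dir.mono fun u hu => (H u hu).1
  have hne : ∀ u ∈ U, inner ℝ (e 2) (S.dir u) ≠ 0 := fun u hu => (H u hu).2.2.1
  set p := S.pt (u₀, v₀) with hp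
  -- The angle of the normal is stationary here, so the original parameter is kept up to a shift.
  set μ : ℝ → ℝ := fun t => u₀ + t with hμ
  have hμ0 : μ 0 = u₀ := add_zero u₀
  have hμd : ∀ t, HasDerivAt μ 1 t := fun t => (hasDerivAt_id t).const_add u₀
  have hμc : ContDiff ℝ k μ := contDiff_const.add contDiff_id
  set ν : ℝ → ℝ := fun t => S.levelParam (e 2) p (μ t) with hν
  set β : ℝ → ℝ := fun t => S.heightScale (e 2) (μ t) with hβ
  have hν0 : ν 0 = v₀ := by
    simp only [hν, hμ0]
    exact levelParam_self (hne u₀ huU)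
  have hW : ∃ ε > 0, ∀ t ∈ Metric.ball (0 : ℝ) ε, μ t ∈ U ∧ S.IsRegular (μ t) (ν t) := by
    refine Metric.eventually_nhds_iff_ball.1 (Eventually.and
      (hμc.continuous.continuousAt.eventually_mem (hUo.mem_nhds (by rwa [hμ0]))) ?_)
    refine eventually_isRegular hreg hμc.continuous.continuousAt ?_ hμ0 hν0
      ((hbU.continuousOn_deriv_of_isOpen hUo hk1).continuousAt (hUo.mem_nhds huU))
      ((hrU.continuousOn_deriv_of_isOpen hUo hk1).continuousAt (hUo.mem_nhds huU)) hdirC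
    refine ContinuousAt.comp (g := S.levelParam (e 2) p) ?_ hμc.continuous.continuousAt
    rw [hμ0]
    exact (contDiffOn_levelParam hbU hrU hne).continuousOn.continuousAt (hUo.mem_nhds huU)
  obtain ⟨ε, hε, HW⟩ := hW
  rw [Real.ball_eq_Ioo, zero_sub, zero_add] at HW
  set I := Set.Ioo (-ε) ε with hI
  have hIo : IsOpen I := isOpen_Ioo
  have h0I : (0 : ℝ) ∈ I := ⟨neg_lt_zero.2 hε, hε⟩
  have hmaps : Set.MapsTo μ I U := fun t ht => (HW t ht).1
  have hβI : ContDiffOn ℝ k β I := (contDiffOn_heightScale hrU hne).comp hμc.contDiffOn hmaps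
  have hνI : ContDiffOn ℝ k ν I := (contDiffOn_levelParam hbU hrU hne).comp hμc.contDiffOn hmaps
  have hbI : ContDiffOn ℝ k (fun t => S.base (μ t)) I := hbU.comp hμc.contDiffOn hmaps
  have hrI : ContDiffOn ℝ k (fun t => S.dir (μ t)) I := hrU.comp hμc.contDiffOn hmaps
  set a : ℝ → E3 := fun t => S.pt (μ t, ν t) with ha
  set R : ℝ → E3 := fun t => β t • S.dir (μ t) with hR
  have haI : ContDiffOn ℝ k a I := hbI.add (hνI.smul hrI)
  have hRI : ContDiffOn ℝ k R I := hβI.smul hrI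
  have hdiff : ∀ {F : Type} [NormedAddCommGroup F] [NormedSpace ℝ F] {φ : ℝ → F},
      ContDiffOn ℝ k φ I → ∀ t ∈ I, HasDerivAt φ (deriv φ t) t := fun hφ t ht =>
    ((hφ.contDiffAt (hIo.mem_nhds ht)).differentiableAt hk0).hasDerivAt
  have hdU : ∀ {φ : ℝ → E3}, ContDiffOn ℝ k φ U → ∀ t ∈ I, DifferentiableAt ℝ φ (μ t) :=
    fun hφ t ht => (hφ.contDiffAt (hUo.mem_nhds (hmaps ht))).differentiableAt hk0
  have hader : ∀ t ∈ I, deriv a t =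
      (1 : ℝ) • S.du (μ t) (ν t) + deriv ν t • S.dir (μ t) := fun t ht =>
    (hasDerivAt_pt_comp (hdU hbU t ht) (hdU hrU t ht) (hμd t) (hdiff hνI t ht)).deriv
  have hRder : ∀ t ∈ I, deriv R t =
      β t • deriv S.dir (μ t) + deriv β t • S.dir (μ t) := fun t ht => by
    have h1 := (hdU hrU t ht).hasDerivAt.scomp t (hμd t)
    rw [one_smul] at h1
    exact ((hdiff hβI t ht).smul h1).deriv
  have hnormal : ∀ t ∈ I, S.IsNormalAt (μ t) (n (μ t)) := fun t ht =>
    (hnJ _ (H _ (hmaps ht)).2.1).2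
  have hna : ∀ t ∈ I, inner ℝ (n (μ t)) (deriv a t) = 0 := fun t ht => by
    rw [hader t ht, (hnormal t ht).inner_smul_du_add]
  have hnR : ∀ t ∈ I, inner ℝ (n (μ t)) (deriv R t) = 0 := fun t ht => by
    rw [hRder t ht, inner_add_right, inner_smul_right, inner_smul_right,
      (hnormal t ht).inner_deriv_dir, (hnormal t ht).1, mul_zero, mul_zero, add_zero]
  have ha2 : ∀ t ∈ I, inner ℝ (e 2) (a t) = inner ℝ (e 2) p := fun t ht => by
    have := inner_pt_levelParam (S := S) (p := p) (x := 0) (hne _ (hmaps ht))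
    rwa [mul_zero, add_zero, add_zero] at this
  have haz : ∀ t ∈ I, inner ℝ (e 2) (deriv a t) = 0 := fun t ht =>
    inner_deriv_eq_zero_of_eventually_const (hdiff haI t ht)
      (eventually_of_mem (hIo.mem_nhds ht) ha2)
  have hR2 : ∀ t ∈ I, inner ℝ (e 2) (R t) = 1 := fun t ht =>
    inner_heightScale_smul_dir (hne _ (hmaps ht))
  have hane : ∀ t ∈ I, deriv a t ≠ 0 := fun t ht => by
    rw [hader t ht]
    exact (HW t ht).2.smul_du_add_ne_zero one_ne_zero
  have ha0 : a 0 = p := by simp only [ha, hμ0, hν0, hp]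
  have hβ0 : β 0 = ‖S.dir u₀‖⁻¹ := by simp only [hβ, heightScale, hμ0, hin0]
  have hR0 : R 0 = e 2 := by simp only [hR, hβ0, hμ0, he2]
  set Γ : RuledSurface := ⟨I, a, fun _ => e 2⟩ with hΓ
  have hΓdu : ∀ t v, Γ.du t v = deriv a t := fun t v => by simp [du, hΓ]
  have hΓreg : ∀ t ∈ I, ∀ v, Γ.IsRegular t v := fun t ht v => by
    rw [IsRegular, hΓdu, LinearIndependent.pair_iff]
    intro c d hcd
    have h1 := congrArg (inner ℝ (e 2)) hcd
    simp only [hΓ, inner_add_right, inner_smul_right, haz t ht, inner_zero_right, e.inner_eq_ite,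
      if_true, mul_zero, zero_add, mul_one] at h1
    subst h1
    rw [zero_smul, add_zero] at hcd
    exact ⟨(smul_eq_zero.1 hcd).resolve_right (hane t ht), rfl⟩
  -- The tangent of the section is orthogonal to `n` and to `e 2`, so the projection of `n` along `e
  -- 2` is normal to the cylinder. It is nonzero near `u₀`, where `n` itself is orthogonal to `e 2`.
  set m : ℝ → E3 := fun t => n (μ t) - inner ℝ (e 2) (n (μ t)) • e 2 with hm
  have hmne : ∀ t ∈ I, m t ≠ 0 := fun t ht => (H _ (hmaps ht)).2.2.2
  have hnI : ContDiffOn ℝ k (fun t => n (μ t)) I :=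
    hn.comp hμc.contDiffOn fun t ht => (H _ (hmaps ht)).2.1
  have hmI : ContDiffOn ℝ k m I :=
    hnI.sub ((contDiffOn_const.inner ℝ hnI).smul contDiffOn_const)
  have hmz : ∀ t, inner ℝ (m t) (e 2) = 0 := fun t => by
    simp [hm, inner_sub_left, inner_smul_left, real_inner_comm]
  have hunit : Γ.IsUnitNormalOn (fun t => ‖m t‖⁻¹ • m t) I := fun t ht => by
    refine ⟨?_, IsNormalAt.smul ⟨hmz t, fun v => ?_⟩ _⟩
    · rw [norm_smul, norm_inv, norm_norm, inv_mul_cancel₀ (norm_ne_zero_iff.2 (hmne t ht))]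
    · rw [hΓdu, hm, inner_sub_left, inner_smul_left, hna t ht, haz t ht, mul_zero, sub_zero]
  have hunitC : ContDiffOn ℝ k (fun t => ‖m t‖⁻¹ • m t) I :=
    ((hmI.norm ℝ hmne).inv fun t ht => norm_ne_zero_iff.2 (hmne t ht)).smul hmI
  refine ⟨Γ, μ, ν, ⟨hIo, Set.ordConnected_Ioo, haI, contDiffOn_const, fun _ _ => e.orthonormal.ne_zero 2,
    fun t ht _ _ => ⟨_, I, hIo.mem_nhds ht, subset_rfl, hunitC, hunit⟩⟩,
    ⟨_, hunitC.continuousOn, hunit, e 2, e.orthonormal.ne_zero 2, 0, fun t _ => ?_⟩, h0I, hμ0, hν0,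
    hμc.contDiffOn, hνI, fun t ht => ⟨(H _ (hmaps ht)).1, ?_, (HW t ht).2, hΓreg t ht 0, ?_⟩,
    fun v hv => ⟨(v - ν 0) / β 0, hΓreg 0 h0I _, ?_⟩⟩
  · rw [inner_smul_right, real_inner_comm, hmz, mul_zero]
  · rw [(hμd t).deriv]
    exact one_ne_zero
  · simp [pt, hΓ, ha]
  · have hev : ∀ {P : ℝ → Prop}, (∀ t ∈ I, P t) → ∀ᶠ t in 𝓝 0, P t :=
      fun h => eventually_of_mem (hIo.mem_nhds h0I) h
    have hU0 := hUo.mem_nhds huU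
    refine secondOrderContact_of_chart (μ := μ) (ν := ν) (β := β) (τ := fun u => u - u₀)
      (X := fun s => a s.1 + s.2 • R s.1) hv
      ((hbU.contDiffAt hU0).differentiableAt hk0) ((hrU.contDiffAt hU0).differentiableAt hk0)
      (by fun_prop) (sub_self u₀) (Eventually.of_forall fun u => by simp [hμ])
      (hνI.continuousOn.continuousAt (hIo.mem_nhds h0I))
      (hβI.continuousOn.continuousAt (hIo.mem_nhds h0I)) (by rw [hβ0]; exact inv_ne_zero hrn)
      (Eventually.of_forall fun t z => ?_) rfl ?_ fun V hV => ?_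
    · rw [pt_add, mul_comm, mul_smul]
    · simp [pt, hΓ, hR0]
    · refine cylinder_infDist_isLittleO (N := fun t => n (μ t)) (a' := deriv a) (R' := deriv R)
        (p := p) (by simp only [hμ0, he0]) ?_ (hev (hdiff haI))
        ((haI.continuousOn_deriv_of_isOpen hIo hk1).continuousAt (hIo.mem_nhds h0I))
        (hev (hdiff hRI))
        ((hRI.continuousOn_deriv_of_isOpen hIo hk1).continuousAt (hIo.mem_nhds h0I))
        (hev hna) (hev hnR) (hev hR2) (hev ha2) ha0 hR0 ?_ hV
      · rw [← hμ0] at hn0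
        exact (hn0.scomp 0 (hμd 0)).congr_deriv (smul_zero _)
      -- Were the component along `e 1` zero, all three components of the velocity of the section
      -- would vanish, against regularity.
      · intro h1
        have h2 := frame_expansion e 0 (deriv a 0)
        have h3 := hna 0 h0I
        rw [hμ0, ← he0] at h3
        rw [radial_zero, tangential_zero, h1, h3, haz 0 h0I] at h2
        exact hane 0 h0I (by simpa using h2)

end RuledSurface

/-- Two orthonormal vectors, rotated in their plane such that the slope of the second with respect
to the third axis is `κ`, and a third vector orthogonal to them as second axis. -/
theorem exists_orthonormalBasis_rotated {x y z : E3} (hx : ‖x‖ = 1) (hy : ‖y‖ = 1) (hz : ‖z‖ = 1)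
    (hxy : inner ℝ x y = 0) (hxz : inner ℝ x z = 0) (hyz : inner ℝ y z = 0) (κ : ℝ) :
    ∃ e : OrthonormalBasis (Fin 3) ℝ E3, ∃ d : ℝ, 0 < d ∧ e 1 = z ∧ x = d • (e 0 - κ • e 2) ∧
      y = d • (κ • e 0 + e 2) := by
  set d := (Real.sqrt (1 + κ ^ 2))⁻¹ with hd
  have hpos : 0 < 1 + κ ^ 2 := by positivity
  have hd0 : 0 < d := inv_pos.2 (Real.sqrt_pos.2 hpos)
  have hd2 : d * d * (1 + κ ^ 2) = 1 := by
    rw [hd, ← mul_inv, Real.mul_self_sqrt hpos.le, inv_mul_cancel₀ hpos.ne']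
  have hyx : inner ℝ y x = 0 := by rw [real_inner_comm, hxy]
  have hzx : inner ℝ z x = 0 := by rw [real_inner_comm, hxz]
  have hzy : inner ℝ z y = 0 := by rw [real_inner_comm, hyz]
  have hxx : inner ℝ x x = 1 := by rw [real_inner_self_eq_norm_sq, hx, one_pow]
  have hyy : inner ℝ y y = 1 := by rw [real_inner_self_eq_norm_sq, hy, one_pow]
  have hzz : inner ℝ z z = 1 := by rw [real_inner_self_eq_norm_sq, hz, one_pow]
  have h11 : inner ℝ (d • (x + κ • y)) (d • (x + κ • y)) = 1 := by
    simp only [inner_add_left, inner_add_right, inner_smul_left, inner_smul_right, hxx, hyy, hxy,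
      hyx, conj_trivial]
    linear_combination hd2
  have h33 : inner ℝ (d • (y - κ • x)) (d • (y - κ • x)) = 1 := by
    simp only [inner_sub_left, inner_sub_right, inner_smul_left, inner_smul_right, hxx, hyy, hxy,
      hyx, conj_trivial]
    linear_combination hd2
  have h13 : inner ℝ (d • (x + κ • y)) (d • (y - κ • x)) = 0 := by
    simp only [inner_add_left, inner_sub_right, inner_smul_left, inner_smul_right, hxx, hyy, hxy,
      hyx, conj_trivial]
    ring
  have h31 : inner ℝ (d • (y - κ • x)) (d • (x + κ • y)) = 0 := by rw [real_inner_comm, h13]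
  have h12 : inner ℝ (d • (x + κ • y)) z = 0 := by
    simp [inner_add_left, inner_smul_left, hxz, hyz]
  have h21 : inner ℝ z (d • (x + κ • y)) = 0 := by rw [real_inner_comm, h12]
  have h32 : inner ℝ (d • (y - κ • x)) z = 0 := by
    simp [inner_sub_left, inner_smul_left, hxz, hyz]
  have h23 : inner ℝ z (d • (y - κ • x)) = 0 := by rw [real_inner_comm, h32]
  -- The first and third vectors come from solving the two required relations for `e 0` and `e 2`;
  -- `d` is the normalizing factor.
  have hv : Orthonormal ℝ ![d • (x + κ • y), z, d • (y - κ • x)] := by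
    rw [orthonormal_iff_ite]
    intro i j
    fin_cases i <;> fin_cases j
    exacts [h11, h12, h13, h21, hzz, h23, h31, h32, h33]
  obtain ⟨e, he⟩ := Orthonormal.exists_orthonormalBasis_extension_of_card_eq
    (ι := Fin 3) (by simp) (v := ![d • (x + κ • y), z, d • (y - κ • x)]) (s := Set.univ)
    (hv.comp _ Subtype.val_injective)
  have h0 : e 0 = d • (x + κ • y) := he 0 trivial
  have h2 : e 2 = d • (y - κ • x) := he 2 trivial
  refine ⟨e, d, hd0, he 1 trivial, ?_, ?_⟩
  · rw [h0, h2]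
    linear_combination (norm := module) (-hd2) • x
  · rw [h0, h2]
    linear_combination (norm := module) (-hd2) • y

/-! ### Surfaces of constant inclination and rotational cones. -/

section ConstantInclination

open RuledSurface

variable {J : Set ℝ} {o : E3} {e : OrthonormalBasis (Fin 3) ℝ E3} {h : ℝ → ℝ} {κ : ℝ}

theorem envelope_const_dir (t : ℝ) :
    (envelope J o e h (fun _ => -κ)).dir t = κ • radial e t + e 2 := by
  simp [envelope]

theorem envelope_const_du {t : ℝ} (hh : DifferentiableAt ℝ h t)
    (hh' : DifferentiableAt ℝ (deriv h) t) (v : ℝ) :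
    (envelope J o e h (fun _ => -κ)).du t v =
      -(h t + deriv (deriv h) t - v * κ) • tangential e t := by
  have h1 : HasDerivAt (envelope J o e h (fun _ => -κ)).base
      (-(h t + deriv (deriv h) t) • tangential e t) t := by
    refine ((hasDerivAt_support_curve (e := e) hh.hasDerivAt
      hh'.hasDerivAt).const_add o).congr_of_eventuallyEq (Eventually.of_forall fun s => ?_)
    simp only [envelope]
    module
  have h2 : HasDerivAt (envelope J o e h (fun _ => -κ)).dir (κ • tangential e t) t :=
    (((hasDerivAt_radial e t).const_smul κ).add_const (e 2)).congr_of_eventuallyEq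
      (Eventually.of_forall envelope_const_dir)
  rw [du, h1.deriv, h2.deriv]
  module

theorem envelope_const_isRegular {t v : ℝ} (hh : DifferentiableAt ℝ h t)
    (hh' : DifferentiableAt ℝ (deriv h) t) (hne : h t + deriv (deriv h) t - v * κ ≠ 0) :
    (envelope J o e h (fun _ => -κ)).IsRegular t v := by
  rw [RuledSurface.IsRegular, envelope_const_du hh hh', envelope_const_dir, LinearIndependent.pair_iff]
  intro c d hcd
  have h1 := congrArg (inner ℝ (e 2)) hcd
  have h2 := congrArg (inner ℝ (tangential e t)) hcd
  simp only [inner_add_right, inner_smul_right, inner_axis_tangential, inner_axis_radial,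
    inner_tangential_axis, inner_tangential_tangential, inner_tangential_radial, sub_self,
    Real.sin_zero, Real.cos_zero, e.inner_eq_one, inner_zero_right, mul_zero, mul_one, add_zero,
    zero_add] at h1 h2
  exact ⟨(mul_eq_zero.1 h2).resolve_right (neg_ne_zero.2 hne), h1⟩

theorem envelope_const_isNormalAt {t : ℝ} (hh : DifferentiableAt ℝ h t)
    (hh' : DifferentiableAt ℝ (deriv h) t) :
    (envelope J o e h (fun _ => -κ)).IsNormalAt t (radial e t - κ • e 2) := by
  refine ⟨?_, fun v => ?_⟩
  · simp [envelope_const_dir, inner_add_right, inner_sub_left, inner_smul_left, inner_smul_right,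
      norm_radial]
  · simp [envelope_const_du hh hh', inner_sub_left, inner_smul_left, inner_smul_right,
      inner_radial_tangential]

theorem norm_radial_sub_smul_axis (t : ℝ) : ‖radial e t - κ • e 2‖ = Real.sqrt (1 + κ ^ 2) := by
  have h1 : inner ℝ (radial e t - κ • e 2) (radial e t - κ • e 2) = 1 + κ ^ 2 := by
    simp only [inner_sub_left, inner_sub_right, inner_smul_left, inner_smul_right,
      inner_radial_radial, inner_radial_axis, inner_axis_radial, e.inner_eq_one, sub_self,
      Real.cos_zero, conj_trivial]
    ring
  rw [norm_eq_sqrt_real_inner, h1]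

theorem envelope_const_isUnitNormalOn
    (hh : ∀ t ∈ J, DifferentiableAt ℝ h t ∧ DifferentiableAt ℝ (deriv h) t) :
    (envelope J o e h (fun _ => -κ)).IsUnitNormalOn
      (fun t => (Real.sqrt (1 + κ ^ 2))⁻¹ • (radial e t - κ • e 2)) J := fun t ht => by
  have : 0 < Real.sqrt (1 + κ ^ 2) := Real.sqrt_pos.2 (by positivity)
  refine ⟨?_, (envelope_const_isNormalAt (hh t ht).1 (hh t ht).2).smul _⟩
  rw [norm_smul, norm_radial_sub_smul_axis, Real.norm_of_nonneg (inv_nonneg.2 this.le),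
    inv_mul_cancel₀ this.ne']

theorem contDiff_const_inclination_normal {k : WithTop ℕ∞} :
    ContDiff ℝ k (fun t => (Real.sqrt (1 + κ ^ 2))⁻¹ • (radial e t - κ • e 2)) :=
  ((contDiff_radial e).sub contDiff_const).const_smul (Real.sqrt (1 + κ ^ 2))⁻¹

theorem envelope_const_isDevelopable {k : ℕ∞} (hJ : IsOpen J) (hJc : J.OrdConnected)
    (hh : ContDiffOn ℝ k h J) (hh' : ContDiffOn ℝ k (deriv h) J)
    (hd : ∀ t ∈ J, DifferentiableAt ℝ h t ∧ DifferentiableAt ℝ (deriv h) t) :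
    (envelope J o e h (fun _ => -κ)).IsDevelopable k where
  isOpen_dom := hJ
  ordConnected_dom := hJc
  contDiffOn_base := (contDiffOn_const.sub (hh.smul (contDiff_radial e).contDiffOn)).sub
    (hh'.smul (contDiff_tangential e).contDiffOn)
  contDiffOn_dir := by
    have : ContDiff ℝ k (fun t => κ • radial e t + e 2) :=
      (ContDiff.smul (f := fun _ => κ) contDiff_const (contDiff_radial e)).add contDiff_const
    exact this.contDiffOn.congr fun t _ => envelope_const_dir t
  dir_ne_zero t _ h0 := by
    have := congrArg (inner ℝ (e 2)) h0
    simp [envelope_const_dir, inner_add_right, inner_smul_right] at this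
  exists_normal t ht _ _ := ⟨_, J, hJ.mem_nhds ht, subset_rfl,
    contDiff_const_inclination_normal.contDiffOn, envelope_const_isUnitNormalOn hd⟩

theorem envelope_const_hasPlanarGaussImage
    (hd : ∀ t ∈ J, DifferentiableAt ℝ h t ∧ DifferentiableAt ℝ (deriv h) t) :
    (envelope J o e h (fun _ => -κ)).HasPlanarGaussImage :=
  ⟨_, (contDiff_const_inclination_normal (k := 0)).continuous.continuousOn,
    envelope_const_isUnitNormalOn hd, e 2, e.orthonormal.ne_zero 2,
    -((Real.sqrt (1 + κ ^ 2))⁻¹ * κ), fun t _ => by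
      simp [inner_smul_right, inner_sub_right]⟩

/-- The circle of radius `|ρ|` touching the first line at `o` has the support function `ρ (1 - cos
t)`, because `cos t • radial - sin t • tangential = e 0`. Its 2-jet at `0` is `(0, 0, ρ)`, that of
the cross section. -/
theorem rotationalCone_eq_envelope (ρ : ℝ) :
    rotationalCone e (o + ρ • e 0) ρ κ =
      envelope Set.univ o e (fun t => ρ * (1 - Real.cos t)) (fun _ => -κ) := by
  have hd : deriv (fun t => ρ * (1 - Real.cos t)) = fun t => ρ * Real.sin t := by
    funext t
    simp
  simp only [rotationalCone, envelope, hd]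
  congr 1
  · funext t
    have h1 := Real.sin_sq_add_cos_sq t
    simp only [radial, tangential]
    linear_combination (norm := module) (-ρ * h1) • e 0
  · funext t
    simp

end ConstantInclination

/-! ### The angular chart at a ruling that is not an inflection ruling. -/

namespace RuledSurface

/-- Coordinates of a developable surface near a ruling which is not an inflection ruling: `t` is the
angle of the tangents of the cross section through `S.pt (u₀, v₀)`, and the coefficient
`f - κ` of the tangent planes has the stationary value `-κ` of second order. -/
structure EnvelopeChart (S : RuledSurface) (k : ℕ∞) (u₀ v₀ : ℝ) (I : Set ℝ)
    (e : OrthonormalBasis (Fin 3) ℝ E3) (κ : ℝ) (μ ν β τ h f : ℝ → ℝ) : Prop where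
  isOpen : IsOpen I
  ordConnected : I.OrdConnected
  zero_mem : (0 : ℝ) ∈ I
  μ_zero : μ 0 = u₀
  ν_zero : ν 0 = v₀
  contDiffOn_μ : ContDiffOn ℝ k μ I
  contDiffOn_ν : ContDiffOn ℝ k ν I
  contDiffOn_β : ContDiffOn ℝ k β I
  contDiffOn_h : ContDiffOn ℝ (k + 1 : ℕ∞) h I
  contDiffOn_f : ContDiffOn ℝ (k + 1 : ℕ∞) f I
  differentiableAt_τ : DifferentiableAt ℝ τ u₀
  τ_zero : τ u₀ = 0
  μ_τ : ∀ᶠ u in 𝓝 u₀, μ (τ u) = u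
  h_zero : h 0 = 0
  deriv_h_zero : deriv h 0 = 0
  f_zero : f 0 = 0
  deriv_f_zero : deriv f 0 = 0
  deriv_deriv_f_zero : deriv (deriv f) 0 = 0
  mem_dom : ∀ t ∈ I, μ t ∈ S.dom
  deriv_μ_ne_zero : ∀ t ∈ I, deriv μ t ≠ 0
  isRegular : ∀ t ∈ I, S.IsRegular (μ t) (ν t)
  β_ne_zero : ∀ t ∈ I, β t ≠ 0
  isNormalAt : ∀ t ∈ I, S.IsNormalAt (μ t) (radial e t + (f t - κ) • e 2)
  pt_eq : ∀ t ∈ I, ∀ v, S.pt (μ t, ν t + β t * v) =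
    (envelope I (S.pt (u₀, v₀)) e h (fun s => f s - κ)).pt (t, v)

/-- Supplies the extra order for `h` and `f`: they are built from `C^k` data, but their first
derivatives are again inner products of `C^k` maps. -/
theorem contDiffOn_add_one_of_deriv {k : ℕ∞} {I : Set ℝ} (hI : IsOpen I) {φ φ' : ℝ → ℝ}
    (hφ : DifferentiableOn ℝ φ I) (hd : ∀ t ∈ I, deriv φ t = φ' t) (hφ' : ContDiffOn ℝ k φ' I) :
    ContDiffOn ℝ (k + 1 : ℕ∞) φ I := by
  have : ((k + 1 : ℕ∞) : WithTop ℕ∞) = (k : WithTop ℕ∞) + 1 := rfl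
  rw [this, contDiffOn_succ_iff_deriv_of_isOpen hI]
  exact ⟨hφ, fun h => absurd h (WithTop.coe_ne_top), hφ'.congr hd⟩

/-- Since `n' ≠ 0`, the angle of the projected normal has nonzero derivative and can replace `u`.
The frame has two tasks: `e 1` parallel to `n'` makes the ruling at `u₀` orthogonal to `e 1`, which
is `f'(0) = 0`, and the slope `κ` of that ruling is adjusted to give `f''(0) = 0`. -/
theorem exists_envelopeChart {k : ℕ∞} (hk : 1 ≤ k) {S : RuledSurface} (hS : S.IsDevelopable k)
    {u₀ v₀ : ℝ} (hu₀ : u₀ ∈ S.dom) (hreg : S.IsRegular u₀ v₀) {n : ℝ → E3} {J : Set ℝ}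
    (hJ : J ∈ 𝓝 u₀) (hn : ContDiffOn ℝ k n J) (hnJ : S.IsUnitNormalOn n J)
    {n' : E3} (hn' : HasDerivAt n n' u₀) (hn'0 : n' ≠ 0) :
    ∃ (I : Set ℝ) (e : OrthonormalBasis (Fin 3) ℝ E3) (κ : ℝ) (μ ν β τ h f : ℝ → ℝ),
      S.EnvelopeChart k u₀ v₀ I e κ μ ν β τ h f := by
  have hk1 : (1 : WithTop ℕ∞) ≤ k := by exact_mod_cast hk
  have hk0 : (k : WithTop ℕ∞) ≠ 0 := (zero_lt_one.trans_le hk1).ne'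
  have hrn : 0 < ‖S.dir u₀‖ := norm_pos_iff.2 (hS.dir_ne_zero u₀ hu₀)
  have hc : 0 < ‖n'‖ := norm_pos_iff.2 hn'0
  have hSnhds := hS.isOpen_dom.mem_nhds hu₀
  have hdird : HasDerivAt S.dir (deriv S.dir u₀) u₀ :=
    ((hS.contDiffOn_dir.contDiffAt hSnhds).differentiableAt hk0).hasDerivAt
  obtain ⟨hn1, hn2⟩ := hnJ u₀ (mem_of_mem_nhds hJ)
  -- orthogonality of the normal, its derivative and the ruling
  have hnn' : inner ℝ (n u₀) n' = 0 := by
    have h1 := hn'.inner ℝ hn'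
    have h2 : ∀ᶠ u in 𝓝 u₀, inner ℝ (n u) (n u) = (1 : ℝ) := by
      filter_upwards [hJ] with u hu
      rw [real_inner_self_eq_norm_sq, (hnJ u hu).1, one_pow]
    have h3 := h1.unique ((hasDerivAt_const u₀ (1 : ℝ)).congr_of_eventuallyEq h2)
    rw [real_inner_comm (n u₀) n'] at h3
    linarith
  have hrn' : inner ℝ (S.dir u₀) n' = 0 := by
    have h1 := hn'.inner ℝ hdird
    have h2 : ∀ᶠ u in 𝓝 u₀, inner ℝ (n u) (S.dir u) = (0 : ℝ) := by
      filter_upwards [hJ] with u hu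
      exact (hnJ u hu).2.1
    have h3 := h1.unique ((hasDerivAt_const u₀ (0 : ℝ)).congr_of_eventuallyEq h2)
    rw [hn2.inner_deriv_dir, zero_add, real_inner_comm] at h3
    exact h3
  -- the frame
  obtain ⟨e, d, hd, he1, hen, her⟩ := exists_orthonormalBasis_rotated (x := n u₀)
    (y := ‖S.dir u₀‖⁻¹ • S.dir u₀) (z := ‖n'‖⁻¹ • n') hn1
    (by rw [norm_smul, norm_inv, norm_norm, inv_mul_cancel₀ hrn.ne'])
    (by rw [norm_smul, norm_inv, norm_norm, inv_mul_cancel₀ hc.ne'])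
    (by rw [inner_smul_right, hn2.1, mul_zero]) (by rw [inner_smul_right, hnn', mul_zero])
    (by rw [inner_smul_left, inner_smul_right, hrn', mul_zero, mul_zero])
    (inner ℝ (‖n'‖⁻¹ • n') (deriv S.dir u₀) / (‖n'‖ * ‖S.dir u₀‖))
  -- This value solves `g''(0) = 0`. It can be prescribed before the frame is known, since it
  -- involves only `e 1`, which the rotation fixes.
  set κ := inner ℝ (‖n'‖⁻¹ • n') (deriv S.dir u₀) / (‖n'‖ * ‖S.dir u₀‖) with hκ
  have hn'e : n' = ‖n'‖ • e 1 := by rw [he1, smul_smul, mul_inv_cancel₀ hc.ne', one_smul]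
  have hre : S.dir u₀ = (‖S.dir u₀‖ * d) • (κ • e 0 + e 2) := by
    rw [mul_smul, ← her, smul_smul, mul_inv_cancel₀ hrn.ne', one_smul]
  have hκe : inner ℝ (e 1) (deriv S.dir u₀) = κ * (‖n'‖ * ‖S.dir u₀‖) := by
    rw [hκ, he1, div_mul_cancel₀ _ (by positivity)]
  have hx0 : inner ℝ (e 0) (n u₀) = d := by
    rw [hen]; simp [inner_smul_right, inner_sub_right, e.inner_eq_ite]
  have hx1 : inner ℝ (e 1) (n u₀) = 0 := by
    rw [hen]; simp [inner_smul_right, inner_sub_right, e.inner_eq_ite]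
  have hx2 : inner ℝ (e 2) (n u₀) = -(d * κ) := by
    rw [hen]; simp [inner_smul_right, inner_sub_right, e.inner_eq_ite]
  have hr2 : inner ℝ (e 2) (S.dir u₀) = ‖S.dir u₀‖ * d := by
    rw [hre, inner_smul_right, inner_add_right, inner_smul_right, ← hre]
    simp [e.inner_eq_ite]
  have hnC : ContinuousAt n u₀ := hn'.continuousAt
  have hdirC := hdird.continuousAt
  have hU : ∃ δ > 0, ∀ u ∈ Metric.ball u₀ δ, u ∈ S.dom ∧ u ∈ J ∧ inner ℝ (e 2) (S.dir u) ≠ 0 ∧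
      0 < inner ℝ (e 0) (n u) := by
    refine Metric.eventually_nhds_iff_ball.1 (Eventually.and hSnhds (Eventually.and hJ
      (Eventually.and ?_ ?_)))
    · exact (ContinuousAt.inner (𝕜 := ℝ) continuousAt_const hdirC).eventually_ne
        (by rw [hr2]; positivity)
    · exact (ContinuousAt.inner (𝕜 := ℝ) continuousAt_const hnC).eventually
        (lt_mem_nhds (hd.trans_eq hx0.symm))
  obtain ⟨δ, hδ, H⟩ := hU
  set U := Metric.ball u₀ δ with hUdef
  have hUo : IsOpen U := Metric.isOpen_ball
  have huU : u₀ ∈ U := Metric.mem_ball_self hδ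
  have hbU := hS.contDiffOn_base.mono fun u hu => (H u hu).1
  have hrU := hS.contDiffOn_dir.mono fun u hu => (H u hu).1
  have hnU := hn.mono fun u hu => (H u hu).2.1
  have hne : ∀ u ∈ U, inner ℝ (e 2) (S.dir u) ≠ 0 := fun u hu => (H u hu).2.2.1
  have hpos : ∀ u ∈ U, 0 < inner ℝ (e 0) (n u) := fun u hu => (H u hu).2.2.2
  -- the angle of the tangents of the cross section
  set τ : ℝ → ℝ := fun u => Real.arctan (inner ℝ (e 1) (n u) / inner ℝ (e 0) (n u)) with hτ
  have hτU : ContDiffOn ℝ k τ U := ((contDiffOn_const.inner ℝ hnU).div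
    (contDiffOn_const.inner ℝ hnU) fun u hu => (hpos u hu).ne').arctan
  have hτ0 : τ u₀ = 0 := by simp [hτ, hx1]
  have hτd : HasDerivAt τ (‖n'‖ / d) u₀ := by
    have h1 := ((hasDerivAt_const u₀ (e 1)).inner ℝ hn').div
      ((hasDerivAt_const u₀ (e 0)).inner ℝ hn') (by rw [hx0]; exact hd.ne')
    refine h1.arctan.congr_deriv ?_
    have h2 : inner ℝ (e 1) n' = ‖n'‖ := by
      rw [hn'e, inner_smul_right, ← hn'e]; simp
    simp only [Pi.div_apply, hx0, hx1, h2, inner_zero_left]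
    field_simp
    ring
  obtain ⟨μ, ε₀, hε₀, hμC, hμ0, hμ, hμτ⟩ := exists_contDiffOn_local_inverse hk1 hUo huU hτU hτ0
    (by rw [hτd.deriv]; positivity)
  have h0ε₀ : (0 : ℝ) ∈ Set.Ioo (-ε₀) ε₀ := ⟨neg_lt_zero.2 hε₀, hε₀⟩
  have hμcont : ContinuousAt μ 0 := hμC.continuousOn.continuousAt (isOpen_Ioo.mem_nhds h0ε₀)
  set p := S.pt (u₀, v₀) with hp
  set ν : ℝ → ℝ := fun t => S.levelParam (e 2) p (μ t) with hν
  set β : ℝ → ℝ := fun t => S.heightScale (e 2) (μ t) with hβ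
  have hν0 : ν 0 = v₀ := by
    simp only [hν, hμ0]
    exact levelParam_self (hne u₀ huU)
  have hW : ∃ ε > 0, ∀ t ∈ Metric.ball (0 : ℝ) ε,
      t ∈ Set.Ioo (-ε₀) ε₀ ∧ S.IsRegular (μ t) (ν t) := by
    refine Metric.eventually_nhds_iff_ball.1 (Eventually.and (isOpen_Ioo.mem_nhds h0ε₀) ?_)
    refine eventually_isRegular hreg hμcont ?_ hμ0 hν0
      ((hbU.continuousOn_deriv_of_isOpen hUo hk1).continuousAt (hUo.mem_nhds huU))
      ((hrU.continuousOn_deriv_of_isOpen hUo hk1).continuousAt (hUo.mem_nhds huU)) hdirC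
    refine ContinuousAt.comp (g := S.levelParam (e 2) p) ?_ hμcont
    rw [hμ0]
    exact (contDiffOn_levelParam hbU hrU hne).continuousOn.continuousAt (hUo.mem_nhds huU)
  obtain ⟨ε, hε, HW⟩ := hW
  rw [Real.ball_eq_Ioo, zero_sub, zero_add] at HW
  set I := Set.Ioo (-ε) ε with hI
  have hIo : IsOpen I := isOpen_Ioo
  have h0I : (0 : ℝ) ∈ I := ⟨neg_lt_zero.2 hε, hε⟩
  have hμI : ContDiffOn ℝ k μ I := hμC.mono fun t ht => (HW t ht).1
  have hmaps : Set.MapsTo μ I U := fun t ht => (hμ t (HW t ht).1).1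
  have hτμ : ∀ t ∈ I, τ (μ t) = t := fun t ht => (hμ t (HW t ht).1).2.1
  have hβI : ContDiffOn ℝ k β I := (contDiffOn_heightScale hrU hne).comp hμI hmaps
  have hνI : ContDiffOn ℝ k ν I := (contDiffOn_levelParam hbU hrU hne).comp hμI hmaps
  have hbI : ContDiffOn ℝ k (fun t => S.base (μ t)) I := hbU.comp hμI hmaps
  have hrI : ContDiffOn ℝ k (fun t => S.dir (μ t)) I := hrU.comp hμI hmaps
  have hnI : ContDiffOn ℝ k (fun t => n (μ t)) I := hnU.comp hμI hmaps
  set a : ℝ → E3 := fun t => S.pt (μ t, ν t) with ha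
  set R : ℝ → E3 := fun t => β t • S.dir (μ t) with hR
  have haI : ContDiffOn ℝ k a I := hbI.add (hνI.smul hrI)
  have hRI : ContDiffOn ℝ k R I := hβI.smul hrI
  have hdiff : ∀ {F : Type} [NormedAddCommGroup F] [NormedSpace ℝ F] {φ : ℝ → F},
      ContDiffOn ℝ k φ I → ∀ t ∈ I, HasDerivAt φ (deriv φ t) t := fun hφ t ht =>
    ((hφ.contDiffAt (hIo.mem_nhds ht)).differentiableAt hk0).hasDerivAt
  have hdU : ∀ {φ : ℝ → E3}, ContDiffOn ℝ k φ U → ∀ t ∈ I, DifferentiableAt ℝ φ (μ t) :=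
    fun hφ t ht => (hφ.contDiffAt (hUo.mem_nhds (hmaps ht))).differentiableAt hk0
  have hader : ∀ t ∈ I, deriv a t =
      deriv μ t • S.du (μ t) (ν t) + deriv ν t • S.dir (μ t) := fun t ht =>
    (hasDerivAt_pt_comp (hdU hbU t ht) (hdU hrU t ht) (hdiff hμI t ht) (hdiff hνI t ht)).deriv
  have hRder : ∀ t ∈ I, deriv R t =
      β t • deriv μ t • deriv S.dir (μ t) + deriv β t • S.dir (μ t) := fun t ht =>
    ((hdiff hβI t ht).smul ((hdU hrU t ht).hasDerivAt.scomp t (hdiff hμI t ht))).deriv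
  -- normals of the form `radial + g e₂`
  set g : ℝ → ℝ := fun t => inner ℝ (e 2) (n (μ t)) * Real.cos t / inner ℝ (e 0) (n (μ t)) with hg
  have hgI : ContDiffOn ℝ k g I := ((contDiffOn_const.inner ℝ hnI).mul
    Real.contDiff_cos.contDiffOn).div (contDiffOn_const.inner ℝ hnI)
      fun t ht => (hpos _ (hmaps ht)).ne'
  set N : ℝ → E3 := fun t => radial e t + g t • e 2 with hN
  -- Rescaling `n` to have first coordinate `cos t` makes the second one `sin t`, because `t` is the
  -- arctangent of their quotient.
  have hNn : ∀ t ∈ I, N t = (Real.cos t / inner ℝ (e 0) (n (μ t))) • n (μ t) := fun t ht => by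
    have h1 := hτμ t ht
    have hx := (hpos _ (hmaps ht)).ne'
    have hcos : Real.cos t ≠ 0 := by
      rw [← h1]; exact (Real.cos_arctan_pos _).ne'
    have h2 : Real.sin t = Real.cos t / inner ℝ (e 0) (n (μ t)) * inner ℝ (e 1) (n (μ t)) := by
      have h3 : Real.tan t = inner ℝ (e 1) (n (μ t)) / inner ℝ (e 0) (n (μ t)) := by
        conv_lhs => rw [← h1]
        exact Real.tan_arctan _
      rw [Real.tan_eq_sin_div_cos] at h3
      field_simp at h3 ⊢
      linear_combination h3
    have h4 : Real.cos t = Real.cos t / inner ℝ (e 0) (n (μ t)) * inner ℝ (e 0) (n (μ t)) := by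
      field_simp
    have h5 := e.sum_repr' (n (μ t))
    rw [Fin.sum_univ_three] at h5
    refine Eq.trans ?_ (congrArg (fun y => (Real.cos t / inner ℝ (e 0) (n (μ t))) • y) h5)
    simp only [hN, hg, radial]
    linear_combination (norm := module) h2 • e 1 + h4 • e 0
  have hNS : ∀ t ∈ I, S.IsNormalAt (μ t) (N t) := fun t ht => by
    rw [hNn t ht]
    exact (hnJ _ (H _ (hmaps ht)).2.1).2.smul _
  have hNd : ∀ t ∈ I, HasDerivAt N (tangential e t + deriv g t • e 2) t := fun t ht =>
    (hasDerivAt_radial e t).add ((hdiff hgI t ht).smul_const (e 2))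
  have hNR : ∀ t ∈ I, inner ℝ (N t) (R t) = 0 := fun t ht => by
    rw [hR, inner_smul_right, (hNS t ht).1, mul_zero]
  have hNR' : ∀ t ∈ I, inner ℝ (N t) (deriv R t) = 0 := fun t ht => by
    rw [hRder t ht, inner_add_right, inner_smul_right, inner_smul_right, inner_smul_right,
      (hNS t ht).inner_deriv_dir, (hNS t ht).1, mul_zero, mul_zero, mul_zero, add_zero]
  have hNa' : ∀ t ∈ I, inner ℝ (N t) (deriv a t) = 0 := fun t ht => by
    rw [hader t ht, (hNS t ht).inner_smul_du_add]
  have ha2 : ∀ t ∈ I, inner ℝ (e 2) (a t) = inner ℝ (e 2) p := fun t ht => by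
    have := inner_pt_levelParam (S := S) (p := p) (x := 0) (hne _ (hmaps ht))
    rwa [mul_zero, add_zero, add_zero] at this
  have haz : ∀ t ∈ I, inner ℝ (e 2) (deriv a t) = 0 := fun t ht =>
    inner_deriv_eq_zero_of_eventually_const (hdiff haI t ht)
      (eventually_of_mem (hIo.mem_nhds ht) ha2)
  have hR2 : ∀ t ∈ I, inner ℝ (e 2) (R t) = 1 := fun t ht =>
    inner_heightScale_smul_dir (hne _ (hmaps ht))
  have hRr : ∀ t ∈ I, inner ℝ (radial e t) (R t) = -g t := fun t ht => by
    have := hNR t ht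
    rw [hN, inner_add_left, inner_smul_left, hR2 t ht, conj_trivial, mul_one] at this
    linarith
  -- Differentiating `⟪N, R⟫ = 0`, where `⟪N, R'⟫ = 0` by developability and `⟪e 2, R⟫ = 1`.
  have hg' : ∀ t ∈ I, deriv g t = -inner ℝ (tangential e t) (R t) := fun t ht => by
    have h1 := ((hNd t ht).inner ℝ (hdiff hRI t ht)).unique
      ((hasDerivAt_const t (0 : ℝ)).congr_of_eventuallyEq
        (eventually_of_mem (hIo.mem_nhds ht) hNR))
    rw [hNR' t ht, zero_add, inner_add_left, inner_smul_left, hR2 t ht, conj_trivial, mul_one] at h1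
    linarith
  -- the support function of the cross section
  set h : ℝ → ℝ := fun t => inner ℝ (radial e t) (p - a t) with hh
  have hhI : ContDiffOn ℝ k h I :=
    (contDiff_radial e).contDiffOn.inner ℝ (contDiffOn_const.sub haI)
  -- The velocity of the section is orthogonal to `N` and to `e 2`, hence to `radial e t`; no
  -- derivative of `a` survives.
  have hh' : ∀ t ∈ I, deriv h t = inner ℝ (tangential e t) (p - a t) := fun t ht => by
    have h1 := ((hasDerivAt_radial e t).inner ℝ ((hdiff haI t ht).const_sub p)).deriv
    have h2 := hNa' t ht
    rw [hN, inner_add_left, inner_smul_left, haz t ht, mul_zero, add_zero] at h2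
    rw [inner_neg_right, h2, neg_zero, zero_add] at h1
    exact h1
  have ha0 : a 0 = p := by simp only [ha, hμ0, hν0, hp]
  have hβ0 : β 0 = (‖S.dir u₀‖ * d)⁻¹ := by simp only [hβ, heightScale, hμ0, hr2]
  have hR0 : R 0 = κ • e 0 + e 2 := by
    simp only [hR, hβ0, hμ0]
    rw [hre, smul_smul, ← hre, inv_mul_cancel₀ (by positivity), one_smul]
  have hμ'0 : deriv μ 0 = d / ‖n'‖ := by
    have := (hμ 0 h0ε₀).2.2.2.deriv
    rw [this, hμ0, hτd.deriv, inv_div]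
  have hg0 : g 0 = -κ := by
    simp only [hg, hμ0, hx0, hx2, Real.cos_zero]
    field_simp
  have hg'0 : deriv g 0 = 0 := by
    rw [hg' 0 h0I, hR0]
    simp [inner_add_right, inner_smul_right, e.inner_eq_ite]
  -- Here `g''(0) = ⟪e 0, R(0)⟫ - ⟪e 1, R'(0)⟫`. The first term is `κ`; in the second, the factors
  -- `d` of `β 0` and `deriv μ 0` cancel and `κ` remains.
  have hg''0 : deriv (deriv g) 0 = 0 := by
    have h1 : HasDerivAt (fun t => -inner ℝ (tangential e t) (R t)) _ 0 :=
      ((hasDerivAt_tangential e 0).inner ℝ (hdiff hRI 0 h0I)).neg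
    have h2 := h1.congr_of_eventuallyEq (eventually_of_mem (hIo.mem_nhds h0I) hg')
    rw [h2.deriv, hRder 0 h0I, hμ0, hR0, hβ0, hμ'0, tangential_zero, radial_zero, inner_neg_left,
      inner_add_right, inner_smul_right, inner_smul_right, inner_smul_right, hκe, hre]
    simp only [inner_add_right, inner_smul_right, e.inner_eq_ite]
    rw [← hre]
    simp
    field_simp
    ring
  refine ⟨I, e, κ, μ, ν, β, τ, h, fun t => g t + κ, ?_⟩
  have hfd : deriv (fun t => g t + κ) = deriv g := by funext t; simp
  refine
    { isOpen := hIo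
      ordConnected := Set.ordConnected_Ioo
      zero_mem := h0I
      μ_zero := hμ0
      ν_zero := hν0
      contDiffOn_μ := hμI
      contDiffOn_ν := hνI
      contDiffOn_β := hβI
      contDiffOn_h := contDiffOn_add_one_of_deriv hIo
        (fun t ht => (hdiff hhI t ht).differentiableAt.differentiableWithinAt) hh'
        ((contDiff_tangential e).contDiffOn.inner ℝ (contDiffOn_const.sub haI))
      contDiffOn_f := contDiffOn_add_one_of_deriv hIo
        (fun t ht => ((hdiff hgI t ht).add_const κ).differentiableAt.differentiableWithinAt)
        (fun t ht => by rw [hfd, hg' t ht])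
        ((contDiff_tangential e).contDiffOn.inner ℝ hRI).neg
      differentiableAt_τ := hτd.differentiableAt
      τ_zero := hτ0
      μ_τ := hμτ
      h_zero := by simp [hh, ha0]
      deriv_h_zero := by simp [hh' 0 h0I, ha0]
      f_zero := by simp [hg0]
      deriv_f_zero := by rw [hfd, hg'0]
      deriv_deriv_f_zero := by rw [hfd, hg''0]
      mem_dom := fun t ht => (H _ (hmaps ht)).1
      deriv_μ_ne_zero := fun t ht => by
        rw [(hμ t (HW t ht).1).2.2.2.deriv]
        exact inv_ne_zero (hμ t (HW t ht).1).2.2.1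
      isRegular := fun t ht => (HW t ht).2
      β_ne_zero := fun t ht => inv_ne_zero (hne _ (hmaps ht))
      isNormalAt := fun t ht => by simpa [hN] using hNS t ht
      pt_eq := fun t ht v => ?_ }
  have hgκ : (fun s => g s + κ - κ) = g := by funext s; ring
  have h1 := frame_expansion e t (p - a t)
  have h2 := frame_expansion e t (R t)
  rw [← hh' t ht, inner_sub_right (e 2), ha2 t ht, sub_self, zero_smul, add_zero] at h1
  rw [hRr t ht, hR2 t ht, show inner ℝ (tangential e t) (R t) = -deriv g t by
    rw [hg' t ht, neg_neg], one_smul] at h2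
  have h3 : S.pt (μ t, ν t + β t * v) = a t + v • R t := by
    rw [pt_add, mul_comm, mul_smul]
  rw [h3, hgκ, envelope_pt]
  dsimp only
  rw [h2, show a t = p - (p - a t) by abel, h1]
  module

end RuledSurface

/-! ### Contact and error estimates in the angular chart. -/

theorem ContDiffAt.third_order_derivs {φ : ℝ → ℝ} {t₀ : ℝ} (hφ : ContDiffAt ℝ 3 φ t₀) :
    (∀ᶠ t in 𝓝 t₀, HasDerivAt φ (deriv φ t) t) ∧
      (∀ᶠ t in 𝓝 t₀, HasDerivAt (deriv φ) (deriv (deriv φ) t) t) ∧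
      HasDerivAt (deriv (deriv φ)) (deriv (deriv (deriv φ)) t₀) t₀ := by
  have h2 := (hφ.of_le (by norm_num : (2 : WithTop ℕ∞) ≤ 3)).eventually_differentiableAt_deriv.1
  refine ⟨h2.mono fun t ht => ht.1.hasDerivAt, h2.mono fun t ht => ht.2.hasDerivAt, ?_⟩
  exact ((ContDiffAt.deriv_of_succ (n := 1) (ContDiffAt.deriv_of_succ (n := 2)
    hφ)).differentiableAt (by simp)).hasDerivAt

namespace RuledSurface.EnvelopeChart

variable {S : RuledSurface} {k : ℕ∞} {u₀ v₀ : ℝ} {I : Set ℝ}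
  {e : OrthonormalBasis (Fin 3) ℝ E3} {κ : ℝ} {μ ν β τ h f : ℝ → ℝ}

theorem contDiffAt_two (hk : 1 ≤ k) {φ : ℝ → ℝ} (hI : IsOpen I)
    (hφ : ContDiffOn ℝ (k + 1 : ℕ∞) φ I) {t : ℝ} (ht : t ∈ I) : ContDiffAt ℝ 2 φ t := by
  refine (hφ.contDiffAt (hI.mem_nhds ht)).of_le ?_
  have : (2 : ℕ∞) ≤ k + 1 := by
    rw [← one_add_one_eq_two]
    gcongr
  exact WithTop.coe_le_coe.2 this

theorem contDiffAt_three (hk : 2 ≤ k) {φ : ℝ → ℝ} (hI : IsOpen I)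
    (hφ : ContDiffOn ℝ (k + 1 : ℕ∞) φ I) {t : ℝ} (ht : t ∈ I) : ContDiffAt ℝ 3 φ t := by
  refine (hφ.contDiffAt (hI.mem_nhds ht)).of_le ?_
  have : (3 : ℕ∞) ≤ k + 1 := by
    rw [← two_add_one_eq_three]
    gcongr
  exact WithTop.coe_le_coe.2 this

/-- Computing the velocity at fixed height in two ways: it is this coefficient times a tangential
vector, and also `μ' • du` plus a multiple of `dir`, which is nonzero at a regular point. For `w =
0` it shows that the radius of curvature of the section does not vanish. -/
theorem coefficient_ne_zero (C : S.EnvelopeChart k u₀ v₀ I e κ μ ν β τ h f) (hk : 1 ≤ k)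
    (hS : S.IsDevelopable k) {t w : ℝ} (ht : t ∈ I) (hreg : S.IsRegular (μ t) (ν t + β t * w)) :
    h t + deriv (deriv h) t + w * (f t - κ + deriv (deriv f) t) ≠ 0 := by
  have hk0 : (k : WithTop ℕ∞) ≠ 0 := by
    have : k ≠ 0 := (zero_lt_one.trans_le hk).ne'
    exact_mod_cast this
  have hI := C.isOpen.mem_nhds ht
  have hdom := hS.isOpen_dom.mem_nhds (C.mem_dom t ht)
  have hd : ∀ {φ : ℝ → ℝ}, ContDiffOn ℝ k φ I → HasDerivAt φ (deriv φ t) t := fun hφ =>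
    ((hφ.contDiffAt hI).differentiableAt hk0).hasDerivAt
  have h1 := hasDerivAt_pt_comp (S := S)
    ((hS.contDiffOn_base.contDiffAt hdom).differentiableAt hk0)
    ((hS.contDiffOn_dir.contDiffAt hdom).differentiableAt hk0) (hd C.contDiffOn_μ)
    ((hd C.contDiffOn_ν).add ((hd C.contDiffOn_β).mul_const w))
  have hh2 := (contDiffAt_two hk C.isOpen C.contDiffOn_h ht).eventually_differentiableAt_deriv.1
  have hf2 := (contDiffAt_two hk C.isOpen C.contDiffOn_f ht).eventually_differentiableAt_deriv.1
  have hfd : deriv (fun s => f s - κ) = deriv f := by funext s; simp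
  have h2 := hasDerivAt_envelope_pt (J := I) (o := S.pt (u₀, v₀)) (e := e) (z := w)
    (g := fun s => f s - κ) hh2.self_of_nhds.1 hh2.self_of_nhds.2
    (hf2.self_of_nhds.1.sub_const κ) (by rw [hfd]; exact hf2.self_of_nhds.2)
  have h3 := h1.unique (h2.congr_of_eventuallyEq (eventually_of_mem hI fun s hs => C.pt_eq s hs w))
  rw [hfd] at h3
  intro h0
  rw [h0, neg_zero, zero_smul] at h3
  exact hreg.smul_du_add_ne_zero (C.deriv_μ_ne_zero t ht) h3

/-- Replacing the cross section by a curve with the same curvature element and the tangent planes by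
planes of constant inclination preserves second order contact. -/
theorem exists_secondOrderContact (C : S.EnvelopeChart k u₀ v₀ I e κ μ ν β τ h f) (hk : 1 ≤ k)
    (hS : S.IsDevelopable k) (J : Set ℝ) {h₂ : ℝ → ℝ} (hh₂ : ContDiffAt ℝ 2 h₂ 0) (h0 : h₂ 0 = 0)
    (h1 : deriv h₂ 0 = 0) (h2 : deriv (deriv h₂) 0 = deriv (deriv h) 0) {v : ℝ}
    (hv : S.IsRegular u₀ v) :
    ∃ w, (envelope J (S.pt (u₀, v₀)) e h₂ (fun _ => -κ)).IsRegular 0 w ∧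
      SecondOrderContact S.pt (u₀, v) (envelope J (S.pt (u₀, v₀)) e h₂ (fun _ => -κ)).pt (0, w) := by
  have hk0 : (k : WithTop ℕ∞) ≠ 0 := by
    have : k ≠ 0 := (zero_lt_one.trans_le hk).ne'
    exact_mod_cast this
  have hI := C.isOpen.mem_nhds C.zero_mem
  have hβ0 := C.β_ne_zero 0 C.zero_mem
  have hdom : S.dom ∈ 𝓝 u₀ := by
    have := hS.isOpen_dom.mem_nhds (C.mem_dom 0 C.zero_mem)
    rwa [C.μ_zero] at this
  have hh := contDiffAt_two hk C.isOpen C.contDiffOn_h C.zero_mem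
  have hf := contDiffAt_two hk C.isOpen C.contDiffOn_f C.zero_mem
  have hfd : deriv (fun s => f s - κ) = deriv f := by funext s; simp
  have hh₂d := hh₂.eventually_differentiableAt_deriv.1
  have hhd := hh.eventually_differentiableAt_deriv.1
  have hfdd := hf.eventually_differentiableAt_deriv.1
  set w := (v - ν 0) / β 0 with hw
  -- The coefficient depends on 2-jets only, so it agrees for both surfaces at `t = 0`: regular
  -- points of `S` on the ruling correspond to regular points of the approximating surface.
  have hcoef : h₂ 0 + deriv (deriv h₂) 0 - w * κ ≠ 0 := by
    have := C.coefficient_ne_zero hk hS (t := 0) (w := w) C.zero_mem (by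
      rwa [C.μ_zero, hw, mul_div_cancel₀ _ hβ0, add_sub_cancel])
    rw [C.h_zero, C.f_zero, C.deriv_deriv_f_zero] at this
    rw [h0, h2]
    convert this using 1
    ring
  refine ⟨w, envelope_const_isRegular hh₂d.self_of_nhds.1 hh₂d.self_of_nhds.2 hcoef, ?_⟩
  obtain ⟨hD, hD'⟩ := isLittleO_of_two_jet_eq_zero (D := fun t => h t - h₂ t)
    (D₁ := fun t => deriv h t - deriv h₂ t) (by simp [C.h_zero, h0])
    (by simp [C.deriv_h_zero, h1])
    (by filter_upwards [hh₂d, hhd] with t h3 h4 using h4.1.hasDerivAt.sub h3.1.hasDerivAt)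
    ((hhd.self_of_nhds.2.hasDerivAt.sub hh₂d.self_of_nhds.2.hasDerivAt).congr_deriv
      (by rw [h2, sub_self]))
  obtain ⟨hF, hF'⟩ := isLittleO_of_two_jet_eq_zero C.f_zero C.deriv_f_zero
    (hfdd.mono fun t ht => ht.1.hasDerivAt)
    (hfdd.self_of_nhds.2.hasDerivAt.congr_deriv C.deriv_deriv_f_zero)
  refine secondOrderContact_of_chart hv ((hS.contDiffOn_base.contDiffAt hdom).differentiableAt hk0)
    ((hS.contDiffOn_dir.contDiffAt hdom).differentiableAt hk0) C.differentiableAt_τ C.τ_zero C.μ_τ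
    (C.contDiffOn_ν.continuousOn.continuousAt hI) (C.contDiffOn_β.continuousOn.continuousAt hI) hβ0
    (eventually_of_mem hI C.pt_eq) hw ?_ fun V hV => ?_
  · rw [← sub_eq_zero, envelope_pt_sub, hfd]
    simp [C.h_zero, h0, C.deriv_h_zero, h1, C.f_zero, C.deriv_f_zero]
  · refine envelope_infDist_isLittleO hh₂ contDiffAt_const hD hD' ?_ ?_ ?_ hV
    · simpa using hF
    · simpa [hfd] using hF'
    · simpa [sub_eq_add_neg] using hcoef

/-- The leading terms of the difference to an approximating surface of constant inclination. -/
theorem error_isLittleO (C : S.EnvelopeChart k u₀ v₀ I e κ μ ν β τ h f) (hk : 2 ≤ k) (J : Set ℝ)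
    {h₂ : ℝ → ℝ} (hh₂ : ContDiffAt ℝ 3 h₂ 0) (h0 : h₂ 0 = 0) (h1 : deriv h₂ 0 = 0)
    (h2 : deriv (deriv h₂) 0 = deriv (deriv h) 0) (v : ℝ) :
    (fun t => ‖S.pt (μ t, ν t + β t * v) -
        (envelope J (S.pt (u₀, v₀)) e h₂ (fun _ => -κ)).pt (t, v)‖ -
      |(deriv (deriv (deriv h)) 0 - deriv (deriv (deriv h₂)) 0) / 2
        + 3 * (deriv (deriv (deriv f)) 0 / 6) * v| * t ^ 2) =o[𝓝 0] (fun t : ℝ => t ^ 2) ∧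
    (fun t => |inner ℝ (radial e t) (S.pt (μ t, ν t + β t * v) -
        (envelope J (S.pt (u₀, v₀)) e h₂ (fun _ => -κ)).pt (t, v))| -
      |(deriv (deriv (deriv h)) 0 - deriv (deriv (deriv h₂)) 0) / 6
        + deriv (deriv (deriv f)) 0 / 6 * v| * |t| ^ 3) =o[𝓝 0] (fun t : ℝ => t ^ 3) := by
  obtain ⟨hh, hh', hh''⟩ :=
    (contDiffAt_three hk C.isOpen C.contDiffOn_h C.zero_mem).third_order_derivs
  obtain ⟨hf, hf', hf''⟩ :=
    (contDiffAt_three hk C.isOpen C.contDiffOn_f C.zero_mem).third_order_derivs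
  obtain ⟨hg, hg', hg''⟩ := hh₂.third_order_derivs
  have hfd : deriv (fun s => f s - κ) = deriv f := by funext s; simp
  -- The support functions of the two sections at height `v` differ by `D`; the radial and
  -- tangential components of the error are `-D` and `-D'`.
  obtain ⟨hα, hβ⟩ := taylor_three (D := fun t => h t - h₂ t + v * f t)
    (D₁ := fun t => deriv h t - deriv h₂ t + v * deriv f t)
    (D₂ := fun t => deriv (deriv h) t - deriv (deriv h₂) t + v * deriv (deriv f) t)
    (by simp [C.h_zero, h0, C.f_zero]) (by simp [C.deriv_h_zero, h1, C.deriv_f_zero])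
    (by simp [h2, C.deriv_deriv_f_zero])
    (by filter_upwards [hh, hg, hf] with t h3 h4 h5 using (h3.sub h4).add (h5.const_mul v))
    (by filter_upwards [hh', hg', hf'] with t h3 h4 h5 using (h3.sub h4).add (h5.const_mul v))
    ((hh''.sub hg'').add (hf''.const_mul v))
  have := isLittleO_of_components (e := e)
    (x := fun t => S.pt (μ t, ν t + β t * v) -
      (envelope J (S.pt (u₀, v₀)) e h₂ (fun _ => -κ)).pt (t, v))
    (by
      filter_upwards [C.isOpen.mem_nhds C.zero_mem] with t ht
      rw [C.pt_eq t ht v, envelope_pt_sub, hfd]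
      simp) hα hβ
  convert this using 8 <;> ring

theorem hasDerivAt_radius (C : S.EnvelopeChart k u₀ v₀ I e κ μ ν β τ h f) (hk : 2 ≤ k) :
    HasDerivAt (fun t => h t + deriv (deriv h) t) (deriv (deriv (deriv h)) 0) 0 := by
  obtain ⟨hh, -, hh''⟩ :=
    (contDiffAt_three hk C.isOpen C.contDiffOn_h C.zero_mem).third_order_derivs
  exact (hh.self_of_nhds.add hh'').congr_deriv (by rw [C.deriv_h_zero, zero_add])

theorem isLittleO_inclination (C : S.EnvelopeChart k u₀ v₀ I e κ μ ν β τ h f) (hk : 2 ≤ k) :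
    (fun t => f t - deriv (deriv (deriv f)) 0 / 6 * t ^ 3) =o[𝓝 0] (fun t : ℝ => t ^ 3) := by
  obtain ⟨hf, hf', hf''⟩ :=
    (contDiffAt_three hk C.isOpen C.contDiffOn_f C.zero_mem).third_order_derivs
  exact (taylor_three C.f_zero C.deriv_f_zero C.deriv_deriv_f_zero hf hf' hf'').1

end RuledSurface.EnvelopeChart

/-! ### The two cases combined. -/

theorem theorem1 (k : ℕ∞) (hk : 1 ≤ k) (S : RuledSurface) (hS : S.IsDevelopable k)
    (u₀ v₀ : ℝ) (hu₀ : u₀ ∈ S.dom) (hreg : S.IsRegular u₀ v₀) :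
    ∃ (Γ : RuledSurface) (μ ν : ℝ → ℝ),
      -- Γ is a developable surface with a planar Gauss image
      Γ.IsDevelopable k ∧ Γ.HasPlanarGaussImage ∧
      -- Γ contains a curve a ⊂ S through p, transversal to the rulings
      (0 : ℝ) ∈ Γ.dom ∧ μ 0 = u₀ ∧ ν 0 = v₀ ∧
      ContDiffOn ℝ k μ Γ.dom ∧ ContDiffOn ℝ k ν Γ.dom ∧
      (∀ t ∈ Γ.dom, μ t ∈ S.dom ∧ deriv μ t ≠ 0 ∧ S.IsRegular (μ t) (ν t) ∧
        Γ.IsRegular t 0 ∧ Γ.pt (t, 0) = S.pt (μ t, ν t)) ∧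
      -- second order contact along the entire ruling through p
      (∀ v : ℝ, S.IsRegular u₀ v →
        ∃ w : ℝ, Γ.IsRegular 0 w ∧ SecondOrderContact S.pt (u₀, v) Γ.pt (0, w)) ∧
      -- away from inflection rulings: the shape of Γ, the osculating cone, and the errors
      (¬ S.IsInflection u₀ →
        ∃ (e : OrthonormalBasis (Fin 3) ℝ E3) (h f β : ℝ → ℝ) (κ ρ : ℝ) (Cone : RuledSurface),
          Γ = envelope Γ.dom (S.pt (u₀, v₀)) e h (fun _ => -κ) ∧
          ContDiffOn ℝ (k + 1 : ℕ∞) h Γ.dom ∧ ContDiffOn ℝ (k + 1 : ℕ∞) f Γ.dom ∧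
          h 0 = 0 ∧ deriv h 0 = 0 ∧ ρ = deriv (deriv h) 0 ∧ ρ ≠ 0 ∧
          f 0 = 0 ∧ deriv f 0 = 0 ∧ deriv (deriv f) 0 = 0 ∧
          (∀ t ∈ Γ.dom, Γ.IsNormalAt t (radial e t - κ • e 2)) ∧
          (∀ t ∈ Γ.dom, S.IsNormalAt (μ t) (radial e t + (f t - κ) • e 2)) ∧
          (∀ t ∈ Γ.dom, β t ≠ 0 ∧ ∀ v : ℝ, S.pt (μ t, ν t + β t * v) =
            (envelope Γ.dom (S.pt (u₀, v₀)) e h (fun s => f s - κ)).pt (t, v)) ∧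
          Cone = rotationalCone e (S.pt (u₀, v₀) + ρ • e 0) ρ κ ∧
          (∀ v : ℝ, S.IsRegular u₀ v →
            ∃ w : ℝ, Cone.IsRegular 0 w ∧ SecondOrderContact S.pt (u₀, v) Cone.pt (0, w)) ∧
          (2 ≤ k → ∃ a₃ ρ₁ : ℝ, HasDerivAt (fun t => h t + deriv (deriv h) t) ρ₁ 0 ∧
            (fun t => f t - a₃ * t ^ 3) =o[𝓝 0] (fun t : ℝ => t ^ 3) ∧
            ∀ v : ℝ,
              (fun t => ‖S.pt (μ t, ν t + β t * v) - Γ.pt (t, v)‖ - |3 * a₃ * v| * t ^ 2)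
                =o[𝓝 0] (fun t : ℝ => t ^ 2) ∧
              (fun t => |inner ℝ (radial e t) (S.pt (μ t, ν t + β t * v) - Γ.pt (t, v))|
                - |a₃ * v| * |t| ^ 3) =o[𝓝 0] (fun t : ℝ => t ^ 3) ∧
              (fun t => ‖S.pt (μ t, ν t + β t * v) - Cone.pt (t, v)‖
                - |ρ₁ / 2 + 3 * a₃ * v| * t ^ 2) =o[𝓝 0] (fun t : ℝ => t ^ 2) ∧
              (fun t => |inner ℝ (radial e t) (S.pt (μ t, ν t + β t * v) - Cone.pt (t, v))|
                - |ρ₁ / 6 + a₃ * v| * |t| ^ 3) =o[𝓝 0] (fun t : ℝ => t ^ 3))) := by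
  obtain ⟨n, J, hJ, -, hn, hnJ⟩ := hS.exists_normal u₀ hu₀ v₀ hreg
  have hk1 : (1 : WithTop ℕ∞) ≤ k := by exact_mod_cast hk
  have hk0 : (k : WithTop ℕ∞) ≠ 0 := (zero_lt_one.trans_le hk1).ne'
  have hnd : HasDerivAt n (deriv n u₀) u₀ := ((hn.contDiffAt hJ).differentiableAt hk0).hasDerivAt
  -- In the first case `n` itself witnesses an inflection ruling, so the last clause is vacuous.
  by_cases hn'0 : deriv n u₀ = 0
  · rw [hn'0] at hnd
    obtain ⟨Γ, μ, ν, h1, h2, h3, h4, h5, h6, h7, h8, h9⟩ :=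
      RuledSurface.exists_cylinder_contact hk hS hu₀ hreg hJ hn hnJ hnd
    exact ⟨Γ, μ, ν, h1, h2, h3, h4, h5, h6, h7, h8, h9, fun h => absurd ⟨n, J, hJ, hnJ, hnd⟩ h⟩
  obtain ⟨I, e, κ, μ, ν, β, τ, h, f, C⟩ :=
    RuledSurface.exists_envelopeChart hk hS hu₀ hreg hJ hn hnJ hnd hn'0
  have hd : ∀ t ∈ I, DifferentiableAt ℝ h t ∧ DifferentiableAt ℝ (deriv h) t := fun t ht =>
    (RuledSurface.EnvelopeChart.contDiffAt_two hk C.isOpen C.contDiffOn_h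
      ht).eventually_differentiableAt_deriv.1.self_of_nhds
  have hh : ContDiffOn ℝ ((k : WithTop ℕ∞) + 1) h I := C.contDiffOn_h
  have hρ : ∀ t ∈ I, h t + deriv (deriv h) t ≠ 0 := fun t ht => by
    simpa using C.coefficient_ne_zero hk hS (w := 0) ht (by simpa using C.isRegular t ht)
  have hh2 := RuledSurface.EnvelopeChart.contDiffAt_two hk C.isOpen C.contDiffOn_h C.zero_mem
  set ρ := deriv (deriv h) 0 with hρdef
  -- The osculating circle contributes nothing at third order, so the cone error keeps the full
  -- derivative of the radius; for `Γ` the terms in `h` cancel.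
  have hc3 : deriv (deriv (deriv (fun t => ρ * (1 - Real.cos t)))) 0 = 0 := by simp
  have hcone : ∀ {m : WithTop ℕ∞}, ContDiffAt ℝ m (fun t => ρ * (1 - Real.cos t)) 0 := by
    intro m
    exact (contDiff_const.mul (contDiff_const.sub Real.contDiff_cos)).contDiffAt
  refine ⟨envelope I (S.pt (u₀, v₀)) e h (fun _ => -κ), μ, ν,
    envelope_const_isDevelopable C.isOpen C.ordConnected (hh.of_le le_self_add)
      (hh.deriv_of_isOpen C.isOpen le_rfl) hd,
    envelope_const_hasPlanarGaussImage hd, C.zero_mem, C.μ_zero, C.ν_zero, C.contDiffOn_μ,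
    C.contDiffOn_ν, fun t ht => ⟨C.mem_dom t ht, C.deriv_μ_ne_zero t ht, C.isRegular t ht,
      envelope_const_isRegular (hd t ht).1 (hd t ht).2 (by simpa using hρ t ht), ?_⟩,
    fun v hv => C.exists_secondOrderContact hk hS I hh2 C.h_zero C.deriv_h_zero rfl hv,
    fun _ => ⟨e, h, f, β, κ, ρ, rotationalCone e (S.pt (u₀, v₀) + ρ • e 0) ρ κ, rfl,
      C.contDiffOn_h, C.contDiffOn_f, C.h_zero, C.deriv_h_zero, rfl, ?_, C.f_zero, C.deriv_f_zero,
      C.deriv_deriv_f_zero, fun t ht => envelope_const_isNormalAt (hd t ht).1 (hd t ht).2,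
      C.isNormalAt, fun t ht => ⟨C.β_ne_zero t ht, C.pt_eq t ht⟩, rfl, fun v hv => ?_,
      fun hk2 => ⟨deriv (deriv (deriv f)) 0 / 6, deriv (deriv (deriv h)) 0,
        C.hasDerivAt_radius hk2, C.isLittleO_inclination hk2, fun v => ?_⟩⟩⟩
  -- At height `0` the coefficient of `z` plays no role, so `Γ` and `S` share the section.
  · have := C.pt_eq t ht 0
    rw [mul_zero, add_zero] at this
    rw [this, envelope_pt, envelope_pt]
    simp
  · simpa [C.h_zero] using hρ 0 C.zero_mem
  · rw [rotationalCone_eq_envelope]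
    exact C.exists_secondOrderContact hk hS Set.univ hcone (by simp) (by simp)
      (by simpa using hρdef) hv
  · have h3 := RuledSurface.EnvelopeChart.contDiffAt_three hk2 C.isOpen C.contDiffOn_h C.zero_mem
    have hΓ := C.error_isLittleO hk2 I h3 C.h_zero C.deriv_h_zero rfl v
    have hK := C.error_isLittleO hk2 Set.univ hcone (by simp) (by simp)
      (by simpa using hρdef) v
    rw [sub_self, zero_div, zero_add, zero_div, zero_add] at hΓ
    rw [hc3, sub_zero] at hK
    rw [rotationalCone_eq_envelope]
    exact ⟨hΓ.1, hΓ.2, hK.1, hK.2⟩
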